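/- Let $\mathbb R^4$ carry coordinates $z_1=x_0+ix_1$, $z_2=x_2+ix_3$. Let $S_+=S_-=\mathbb C^2$ and let $\Gamma:S_+\otimes S_-\to\mathbb C^4=\mathbb R^4\otimes\mathbb C$ be given, for $\epsilon=(\epsilon_+,\epsilon_-)\in S_+$ and $s\in S_-$, by $$\Gamma(\epsilon,s)=\sum_i s_i\Big(\epsilon_+\frac{\partial}{\partial\bar z_i}+\epsilon_-\sum_j\epsilon_{ij}\frac{\partial}{\partial z_j}\Big),\qquad \epsilon_{12}=-\epsilon_{21}=1 .$$ The odd elements $Q=(Q_+,Q_-)\in S_+\oplus S_-$ of the supertranslation algebra have bracket $\{Q,Q'\}=\Gamma(Q_+,Q'_-)+\Gamma(Q'_+,Q_-)$, and the nilpotence variety is $Y=\{Q:\{Q,Q\}=0\}$. Let $V$ be a finite-dimensional complex vector space. At $\epsilon\in S_+$, the fields of the $\beta\gamma$ system on $\mathbb R^4$ with values in $V$ are $\Omega^{0,*}(\mathbb C^2)\otimes\big(V\oplus V^\vee d^2z\,[1]\big)$ with differential $\bar\partial_\epsilon=\sum_i d\bar z_i\big(\epsilon_+\partial_{\bar z_i}+\epsilon_-\sum_j\epsilon_{ij}\partial_{z_j}\big)$.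 The dimensional reduction along a real plane $P\subset\mathbb R^4$ consists of the fields whose coefficient functions are invariant under translation by $P$, with the same differential. Call $\epsilon\in S_+$ a point of the two-dimensional holomorphic twist (resp. of the B-model) for $P$ if $\Gamma(\epsilon,S_-)+P_{\mathbb C}$ has dimension three (resp. four). 1. $Y=S_+\cup S_-$, and $S_+\setminus0$ is a connected component of $Y\setminus 0$. For $\epsilon\in S_+\setminus 0$ there is an orthogonal complex structure $J_\epsilon$ on $\mathbb R^4$, inducing the standard orientation, with $T^{0,1}_{J_\epsilon}=\Gamma(\epsilon,S_-)$, and $\epsilon\mapsto J_\epsilon$ induces a homeomorphism from $\mathbb P(S_+)$ to the space of all such complex structures. By a constant linear substitution of the odd generators, $(\Omega^{0,*},\bar\partial_\epsilon)$ is isomorphic to the Dolbeault complex of $(\mathbb R^4,J_\epsilon)$. 2. If $P$ is the $z_2$-plane $\{z_1=0\}$, the points of the holomorphic twist are the $\epsilon\neq0$ with $\epsilon_+\epsilon_-=0$. Pull-back of functions along $z_1:\mathbb R^4\to\mathbb C$ together with the substitution $d\bar z\mapsto d\bar z_1$, $dz\mapsto-d\bar z_2$ is, for all $\epsilon\in S_+$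 simultaneously, an isomorphism from $$\big[\Omega^{*,*}(\mathbb C),\ \epsilon_+\bar\partial+\epsilon_-\partial\big]\otimes\big(V\oplus V^\vee[1]\big)$$ to the reduced fields at $\epsilon$. 3. For an arbitrary real plane $P\subset\mathbb R^4$, there is a basis $a,b$ of $S_+$ such that the points of the holomorphic twist are the nonzero elements of $\mathbb Ca\cup\mathbb Cb$, and all other nonzero points are points of the B-model. For every basis $a,b$ of $S_+$ consisting of points of the holomorphic twist, there are a real linear map $w:\mathbb R^4\to\mathbb C$ with kernel $P$ and a linear isomorphism $h$ from $\mathbb C\,dz\oplus\mathbb C\,d\bar z$ to $\mathbb C\,d\bar z_1\oplus\mathbb C\,d\bar z_2$ such that $\Phi=w^*\otimes\Lambda(h)$ is, for all $x,y\in\mathbb C$ simultaneously, an isomorphism from $[\Omega^{*,*}(\mathbb C),\,x\bar\partial+y\partial]\otimes(V\oplus V^\vee[1])$ to the reduced fields at $\epsilon=xa+yb$. 4. In the situation of 3, the reduced fields form a double complex with differentials $\bar\partial_b$ of bidegree $(1,0)$ and $\bar\partial_a$ of bidegree $(0,1)$, where bidegree $(p,q)$ means $p$ odd generators among those occurring in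 $\bar\partial_b$ and $q$ among those occurring in $\bar\partial_a$ (the second degree being lowered by one on the summand $V^\vee[1]$). The spectral sequence of its filtration by the first degree has as its $E_1$ page the cohomology of the holomorphic twist at $a$, and for $r\ge2$ its page $E_r^{p,q}$ is $\mathrm{gr}^pH^{p+q}$ of the B-model at $a+b$. The map $\Phi$ is bihomogeneous and induces isomorphisms, commuting with all $d_r$, from the pages of the Hodge-to-de Rham spectral sequence of $(\Omega^{*,*}(\mathbb C),\partial,\bar\partial)\otimes(V\oplus V^\vee[1])$ to the pages of this spectral sequence. -/

import Mathlib

open scoped TensorProduct ContDiff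

noncomputable section

namespace BetaGamma

/-! ### The supertranslation algebra of Euclidean `ℝ⁴` and its nilpotence variety

Coordinates on `ℝ⁴`: `z₁ = x₀ + i x₁`, `z₂ = x₂ + i x₃` (indexed below by `0, 1 : Fin 2`). -/

/-- Euclidean four-space. -/
abbrev R4 : Type := EuclideanSpace ℝ (Fin 4)

/-- Complexified (constant-coefficient) translations of `ℝ⁴`: the vector `v` stands for
`∑ j, v j • ∂/∂x_j`. -/
abbrev CVec : Type := Fin 4 → ℂ

/-- A Weyl spinor space (either chirality), with its `U(2)`-adapted basis. The coordinates on `S₊`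
are `(ε₊, ε₋) = (ε 0, ε 1)`. -/
abbrev Spinor : Type := Fin 2 → ℂ

/-- The vectors `∂/∂z_i`. -/
def dZ : Fin 2 → CVec :=
  ![![1 / 2, -Complex.I / 2, 0, 0], ![0, 0, 1 / 2, -Complex.I / 2]]

/-- The vectors `∂/∂z̄_i`. -/
def dZbar : Fin 2 → CVec :=
  ![![1 / 2, Complex.I / 2, 0, 0], ![0, 0, 1 / 2, Complex.I / 2]]

/-- The antisymmetric symbol `ε_{ij}` with `ε_{12} = 1`. -/
def leviCivita (i j : Fin 2) : ℂ := !![0, 1; -1, 0] i j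

/-- For `ε ∈ S₊`, the `i`-th translation `ε₊ ∂/∂z̄_i + ε₋ ε_{ij} ∂/∂z_j`. -/
def nullVec (ε : Spinor) (i : Fin 2) : CVec :=
  ε 0 • dZbar i + ε 1 • ∑ j, leviCivita i j • dZ j

/-- The isomorphism `Γ : S₊ ⊗ S₋ → ℂ⁴`, as the map `s ↦ Γ(ε, s)` for fixed `ε ∈ S₊`. -/
def Gam (ε : Spinor) : Spinor →ₗ[ℂ] CVec :=
  Fintype.linearCombination ℂ (nullVec ε)

/-- The bracket of two odd elements `Q = (Q₊, Q₋)`, `Q' = (Q'₊, Q'₋)` of the supertranslation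
algebra. -/
def bracket (Q Q' : Spinor × Spinor) : CVec := Gam Q.1 Q'.2 + Gam Q'.1 Q.2

/-- The nilpotence variety: the odd elements of square zero. -/
def nilpotenceVariety : Set (Spinor × Spinor) := {Q | bracket Q Q = 0}

/-- The translations that are exact for the supercharge `ε ∈ S₊`. -/
def nullTranslations (ε : Spinor) : Submodule ℂ CVec := LinearMap.range (Gam ε)

/-- The orthogonal complex structures `J` on `ℝ⁴` which induce the standard orientation. -/
def ComplexStructures : Set (Matrix (Fin 4) (Fin 4) ℝ) :=
  {J | J * J = -1 ∧ J.transpose * J = 1 ∧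
    ∀ u v : Fin 4 → ℝ, 0 ≤ (Matrix.of ![u, J.mulVec u, v, J.mulVec v]).det}

/-- The antiholomorphic tangent space `T^{0,1} ⊂ ℂ⁴` of a complex structure `J`. -/
def T01 (J : Matrix (Fin 4) (Fin 4) ℝ) : Submodule ℂ CVec :=
  LinearMap.ker (Matrix.toLin' (J.map (algebraMap ℝ ℂ)) + Complex.I • LinearMap.id)

/-- The complexification of a real subspace of `ℝ⁴`. -/
def complexify (P : Submodule ℝ R4) : Submodule ℂ CVec :=
  Submodule.span ℂ {v | ∃ p ∈ P, v = fun j => (p j : ℂ)}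

/-- The plane `z₁ = 0` in `ℝ⁴`, i.e. the `z₂`-plane. -/
def z2Plane : Submodule ℝ R4 :=
  Submodule.span ℝ {EuclideanSpace.single 2 1, EuclideanSpace.single 3 1}

/-- After reduction along the plane `P`, the translations acting trivially (exact ones together
with those along `P`) span a three-dimensional space: two-dimensional holomorphic twist. -/
def IsHolomorphicTwist (P : Submodule ℝ R4) (ε : Spinor) : Prop :=
  Module.finrank ℂ (nullTranslations ε ⊔ complexify P : Submodule ℂ CVec) = 3

/-- After reduction along the plane `P`, all translations act trivially: topological twist of
type B. -/
def IsBTwist (P : Submodule ℝ R4) (ε : Spinor) : Prop :=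
  Module.finrank ℂ (nullTranslations ε ⊔ complexify P : Submodule ℂ CVec) = 4

/-! ### Forms with constant odd generators -/

section Forms

variable {E : Type*} [NormedAddCommGroup E] [NormedSpace ℝ E]
variable {V : Type*} [NormedAddCommGroup V] [NormedSpace ℂ V]
variable {T : Type*} [AddCommGroup T] [Module ℂ T]

/-- Smooth `V`-valued functions on `E` that are independent of the directions in `P`.
For `P = ⊥` these are all smooth functions. -/
def smoothInv (P : Submodule ℝ E) (V : Type*) [NormedAddCommGroup V] [NormedSpace ℂ V] :
    Submodule ℂ (E → V) where
  carrier := {f | ContDiff ℝ ∞ f ∧ ∀ v ∈ P, ∀ x, f (x + v) = f x}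
  add_mem' := fun hf hg => ⟨hf.1.add hg.1, fun v hv x => by
    simp [hf.2 v hv x, hg.2 v hv x]⟩
  zero_mem' := ⟨contDiff_const, fun _ _ _ => rfl⟩
  smul_mem' := fun c _ hf => ⟨hf.1.const_smul c, fun v hv x => by simp [hf.2 v hv x]⟩

/-- The derivative in the direction of a real vector. -/
def dirDeriv (P : Submodule ℝ E) (V : Type*) [NormedAddCommGroup V] [NormedSpace ℂ V] (v : E) :
    smoothInv P V →ₗ[ℂ] smoothInv P V where
  toFun f := ⟨fun x => fderiv ℝ f.1 x v, by
    refine ⟨(f.2.1.fderiv_right (m := ∞) (by simp)).clm_apply contDiff_const, ?_⟩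
    intro w hw x
    have h : (fun y => f.1 (y + w)) = f.1 := funext (f.2.2 w hw)
    change fderiv ℝ f.1 (x + w) v = fderiv ℝ f.1 x v
    rw [← fderiv_comp_add_right, h]⟩
  map_add' f g := by
    ext x
    have hf : DifferentiableAt ℝ f.1 x := f.2.1.differentiable (by simp) x
    have hg : DifferentiableAt ℝ g.1 x := g.2.1.differentiable (by simp) x
    change fderiv ℝ (f.1 + g.1) x v = _
    rw [fderiv_add hf hg]; rfl
  map_smul' c f := by
    ext x
    have hf : DifferentiableAt ℝ f.1 x := f.2.1.differentiable (by simp) x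
    change fderiv ℝ (c • f.1) x v = _
    rw [fderiv_const_smul hf]; rfl

/-- Forms: smooth functions (independent of `P`) tensored with the exterior algebra on a space `T`
of constant odd generators. -/
abbrev Forms (P : Submodule ℝ E) (V : Type*) [NormedAddCommGroup V] [NormedSpace ℂ V]
    (T : Type*) [AddCommGroup T] [Module ℂ T] : Type _ :=
  smoothInv P V ⊗[ℂ] ExteriorAlgebra ℂ T

/-- The operator `θ ∧ δ(-)` on forms: `f ⊗ λ ↦ δ f ⊗ θ ∧ λ`. -/
def wedgeOp {P : Submodule ℝ E} (δ : smoothInv P V →ₗ[ℂ] smoothInv P V) (θ : T) :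
    Forms P V T →ₗ[ℂ] Forms P V T :=
  TensorProduct.map δ (LinearMap.mulLeft ℂ (ExteriorAlgebra.ι ℂ θ))

/-- The forms of bidegree `(p, q)`: at least when `T = A ⊕ B`, those with `p` odd generators
from `A` and `q` from `B`. -/
def bidegree (P : Submodule ℝ E) (V : Type*) [NormedAddCommGroup V] [NormedSpace ℂ V]
    (A B : Submodule ℂ T) (p q : ℤ) : Submodule ℂ (Forms P V T) :=
  if 0 ≤ p ∧ 0 ≤ q then
    Submodule.map₂ (TensorProduct.mk ℂ (smoothInv P V) (ExteriorAlgebra ℂ T)) ⊤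
      ((A.map (ExteriorAlgebra.ι ℂ)) ^ p.toNat * (B.map (ExteriorAlgebra.ι ℂ)) ^ q.toNat)
  else ⊥

theorem dirDeriv_comm (P : Submodule ℝ E) (v w : E) :
    dirDeriv P V v ∘ₗ dirDeriv P V w = dirDeriv P V w ∘ₗ dirDeriv P V v := by
  ext f x
  have hd : ∀ u : E, ∀ y, fderiv ℝ (fun z => fderiv ℝ f.1 z u) y =
      (ContinuousLinearMap.apply ℝ V u).comp (fderiv ℝ (fderiv ℝ f.1) y) := by
    intro u y
    have h1 : DifferentiableAt ℝ (fderiv ℝ f.1) y :=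
      (f.2.1.fderiv_right (m := ∞) (by simp)).differentiable (by simp) y
    exact ((ContinuousLinearMap.apply ℝ V u).hasFDerivAt.comp y h1.hasFDerivAt).fderiv
  have hs : IsSymmSndFDerivAt ℝ f.1 x :=
    f.2.1.contDiffAt.isSymmSndFDerivAt (by
      rw [minSmoothness_of_isRCLikeNormedField]; exact WithTop.coe_le_coe.2 le_top)
  change fderiv ℝ (fun z => fderiv ℝ f.1 z w) x v = fderiv ℝ (fun z => fderiv ℝ f.1 z v) x w
  rw [hd, hd]
  exact hs v w

theorem wedgeOp_anticomm {P : Submodule ℝ E} {δ δ' : smoothInv P V →ₗ[ℂ] smoothInv P V}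
    (h : δ ∘ₗ δ' = δ' ∘ₗ δ) (θ θ' : T) :
    wedgeOp δ θ ∘ₗ wedgeOp δ' θ' + wedgeOp δ' θ' ∘ₗ wedgeOp δ θ = 0 := by
  refine TensorProduct.ext' fun f l => ?_
  have h1 : δ (δ' f) = δ' (δ f) := LinearMap.congr_fun h f
  have h2 := ExteriorAlgebra.ι_add_mul_swap (R := ℂ) θ θ'
  simp only [wedgeOp, LinearMap.add_apply, LinearMap.comp_apply, TensorProduct.map_tmul,
    LinearMap.mulLeft_apply, LinearMap.zero_apply, h1]
  rw [← TensorProduct.tmul_add, ← mul_assoc, ← mul_assoc, ← add_mul, h2, zero_mul,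
    TensorProduct.tmul_zero]

theorem comp_self_eq_zero {M : Type*} [AddCommMonoid M] [Module ℂ M] {D : M →ₗ[ℂ] M}
    (h : D ∘ₗ D + D ∘ₗ D = 0) : D ∘ₗ D = 0 := by
  have h1 := congrArg (fun L => (2⁻¹ : ℂ) • L) h
  simpa [← two_smul ℂ (D ∘ₗ D), smul_smul] using h1

theorem map_ι_comm (A B : Submodule ℂ T) :
    Commute (A.map (ExteriorAlgebra.ι ℂ)) (B.map (ExteriorAlgebra.ι ℂ)) := by
  have key : ∀ A B : Submodule ℂ T, A.map (ExteriorAlgebra.ι ℂ) * B.map (ExteriorAlgebra.ι ℂ) ≤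
      B.map (ExteriorAlgebra.ι ℂ) * A.map (ExteriorAlgebra.ι ℂ) := by
    intro A B
    rw [Submodule.mul_le]
    rintro _ ⟨a, ha, rfl⟩ _ ⟨b, hb, rfl⟩
    rw [eq_neg_of_add_eq_zero_left (ExteriorAlgebra.ι_add_mul_swap (R := ℂ) a b)]
    exact Submodule.neg_mem _ (Submodule.mul_mem_mul ⟨b, hb, rfl⟩ ⟨a, ha, rfl⟩)
  exact le_antisymm (key A B) (key B A)

theorem wedgeOp_bidegree {P : Submodule ℝ E} (δ : smoothInv P V →ₗ[ℂ] smoothInv P V)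
    {A B : Submodule ℂ T} {θ : T} {p q p' q' : ℤ}
    (h : (θ ∈ A ∧ p' = p + 1 ∧ q' = q) ∨ (θ ∈ B ∧ p' = p ∧ q' = q + 1)) :
    bidegree P V A B p q ≤ (bidegree P V A B p' q').comap (wedgeOp δ θ) := by
  by_cases hpq : 0 ≤ p ∧ 0 ≤ q
  · have hpq' : 0 ≤ p' ∧ 0 ≤ q' := by omega
    rw [bidegree, if_pos hpq, bidegree, if_pos hpq', Submodule.map₂_le]
    intro f _ l hl
    refine Submodule.apply_mem_map₂ _ (Submodule.mem_top (x := δ f)) ?_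
    rw [LinearMap.mulLeft_apply]
    rcases h with ⟨hθ, rfl, rfl⟩ | ⟨hθ, rfl, rfl⟩
    · have e : (p + 1).toNat = p.toNat + 1 := by omega
      rw [e, pow_succ', mul_assoc]
      exact Submodule.mul_mem_mul ⟨θ, hθ, rfl⟩ hl
    · have e : (q + 1).toNat = q.toNat + 1 := by omega
      rw [e, pow_succ', ← mul_assoc, ((map_ι_comm A B).pow_left _).eq, mul_assoc]
      exact Submodule.mul_mem_mul ⟨θ, hθ, rfl⟩ hl
  · rw [bidegree, if_neg hpq]
    exact bot_le

/-- Pull-back of forms along a linear map `w` that kills `P`, with a linear substitution `h` of the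
odd generators: `f ⊗ λ ↦ (f ∘ w) ⊗ Λ(h) λ`. -/
def pullForms {E' T' : Type*} [NormedAddCommGroup E'] [NormedSpace ℝ E'] [AddCommGroup T']
    [Module ℂ T'] (P : Submodule ℝ E) (V : Type*) [NormedAddCommGroup V] [NormedSpace ℂ V]
    (w : E →L[ℝ] E') (hw : ∀ v ∈ P, w v = 0) (h : T' →ₗ[ℂ] T) :
    Forms (⊥ : Submodule ℝ E') V T' →ₗ[ℂ] Forms P V T :=
  TensorProduct.map
    { toFun := fun f => ⟨fun x => f.1 (w x), f.2.1.comp w.contDiff, fun v hv x => by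
        simp [hw v hv]⟩
      map_add' := fun _ _ => rfl
      map_smul' := fun _ _ => rfl }
    (ExteriorAlgebra.map h).toLinearMap

/-- Linear substitution `h` of the odd generators: `f ⊗ λ ↦ f ⊗ Λ(h) λ`. -/
def mapOdd {T' : Type*} [AddCommGroup T'] [Module ℂ T'] (P : Submodule ℝ E) (V : Type*)
    [NormedAddCommGroup V] [NormedSpace ℂ V] (h : T' →ₗ[ℂ] T) : Forms P V T' →ₗ[ℂ] Forms P V T :=
  TensorProduct.map LinearMap.id (ExteriorAlgebra.map h).toLinearMap

end Forms

/-! ### Double complexes and the spectral sequence of the filtration by the first degree -/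

/-- A double complex of complex vector spaces, written on its total space. -/
structure DoubleComplex where
  M : Type*
  [grp : AddCommGroup M]
  [mod : Module ℂ M]
  /-- the piece of bidegree `(p, q)` -/
  K : ℤ → ℤ → Submodule ℂ M
  /-- the differential of bidegree `(1, 0)` -/
  d₁ : M →ₗ[ℂ] M
  /-- the differential of bidegree `(0, 1)` -/
  d₂ : M →ₗ[ℂ] M
  d₁_mem : ∀ p q, K p q ≤ (K (p + 1) q).comap d₁
  d₂_mem : ∀ p q, K p q ≤ (K p (q + 1)).comap d₂
  d₁_sq : d₁ ∘ₗ d₁ = 0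
  d₂_sq : d₂ ∘ₗ d₂ = 0
  anticomm : d₁ ∘ₗ d₂ + d₂ ∘ₗ d₁ = 0

namespace DoubleComplex

attribute [instance] DoubleComplex.grp DoubleComplex.mod

variable (C : DoubleComplex)

/-- The total differential. -/
def d : C.M →ₗ[ℂ] C.M := C.d₁ + C.d₂

/-- Total degree `n`. -/
def G (n : ℤ) : Submodule ℂ C.M := ⨆ p : ℤ, C.K p (n - p)

/-- The decreasing filtration by the first degree. -/
def F (p : ℤ) : Submodule ℂ C.M := ⨆ (p' : ℤ) (_ : p ≤ p') (q : ℤ), C.K p' q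

/-- `Z_r^{p,q}`: elements of `F^p` of total degree `p + q` whose differential lies in `F^{p+r}`. -/
def Z (r p q : ℤ) : Submodule ℂ C.M := C.F p ⊓ C.G (p + q) ⊓ (C.F (p + r)).comap C.d

/-- `Z_{r-1}^{p+1,q-1} + d Z_{r-1}^{p-r+1,q+r-2}`. -/
def B (r p q : ℤ) : Submodule ℂ C.M :=
  C.Z (r - 1) (p + 1) (q - 1) ⊔ (C.Z (r - 1) (p - r + 1) (q + r - 2)).map C.d

/-- The page `E_r^{p,q}` of the spectral sequence. -/
abbrev Page (r p q : ℤ) : Type _ := C.Z r p q ⧸ (C.B r p q).comap (C.Z r p q).subtype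

/-- The class in `E_r^{p,q}` of an element of `Z_r^{p,q}`. -/
abbrev cls (r p q : ℤ) (z : C.Z r p q) : C.Page r p q := Submodule.Quotient.mk z

theorem d_sq (x : C.M) : C.d (C.d x) = 0 := by
  have h1 : C.d₁ (C.d₁ x) = 0 := LinearMap.congr_fun C.d₁_sq x
  have h2 : C.d₂ (C.d₂ x) = 0 := LinearMap.congr_fun C.d₂_sq x
  have h3 : C.d₁ (C.d₂ x) + C.d₂ (C.d₁ x) = 0 := LinearMap.congr_fun C.anticomm x
  have h4 : C.d (C.d x) = C.d₁ (C.d₁ x) + (C.d₁ (C.d₂ x) + C.d₂ (C.d₁ x)) + C.d₂ (C.d₂ x) := by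
    simp only [d, LinearMap.add_apply, map_add]
    abel
  rw [h4, h1, h2, h3]; simp

theorem d_G (n : ℤ) : C.G n ≤ (C.G (n + 1)).comap C.d := by
  refine iSup_le fun p x hx => ?_
  refine Submodule.add_mem (C.G (n + 1)) (x := C.d₁ x) (y := C.d₂ x) ?_ ?_
  · refine Submodule.mem_iSup_of_mem (p + 1) ?_
    have e : n + 1 - (p + 1) = n - p := by ring
    rw [e]; exact C.d₁_mem _ _ hx
  · refine Submodule.mem_iSup_of_mem p ?_
    have e : n + 1 - p = n - p + 1 := by ring
    rw [e]; exact C.d₂_mem _ _ hx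

theorem d_Z (r p q : ℤ) : ∀ z ∈ C.Z r p q, C.d z ∈ C.Z r (p + r) (q - r + 1) := by
  rintro z ⟨⟨_, hG⟩, hd⟩
  refine ⟨⟨hd, ?_⟩, ?_⟩
  · have e : p + r + (q - r + 1) = p + q + 1 := by ring
    rw [e]; exact C.d_G _ hG
  · change C.d (C.d z) ∈ C.F (p + r + r)
    rw [d_sq]; exact Submodule.zero_mem _

/-- The differential `d_r : E_r^{p,q} → E_r^{p+r,q-r+1}` of the spectral sequence,
`[z] ↦ [d z]`. -/
def dr (r p q : ℤ) : C.Page r p q →ₗ[ℂ] C.Page r (p + r) (q - r + 1) :=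
  Submodule.mapQ _ _ (C.d.restrict (C.d_Z r p q)) (by
    rintro ⟨z, hz⟩ hB
    obtain ⟨x, hx, y, hy, hxy⟩ := Submodule.mem_sup.1 (show z ∈ C.B r p q from hB)
    obtain ⟨y', _, rfl⟩ := hy
    change C.d z ∈ C.B r (p + r) (q - r + 1)
    rw [← hxy, map_add, d_sq, add_zero]
    refine Submodule.mem_sup_right ⟨x, ?_, rfl⟩
    have e1 : p + r - r + 1 = p + 1 := by ring
    have e2 : q - r + 1 + r - 2 = q - 1 := by ring
    rw [e1, e2]; exact hx)

/-- Cohomology in bidegree `(p, q)` for the second differential alone. -/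
abbrev H₂ (p q : ℤ) : Type _ :=
  (C.K p q ⊓ LinearMap.ker C.d₂ : Submodule ℂ C.M) ⧸
    ((C.K p (q - 1)).map C.d₂).comap (C.K p q ⊓ LinearMap.ker C.d₂).subtype

/-- The graded piece `gr^p H^{p+q}` of the cohomology of the total differential, for the filtration
induced by `F`. -/
abbrev GrH (p q : ℤ) : Type _ :=
  (C.F p ⊓ C.G (p + q) ⊓ LinearMap.ker C.d : Submodule ℂ C.M) ⧸
    ((C.F (p + 1) ⊓ C.G (p + q) ⊓ LinearMap.ker C.d) ⊔ (C.G (p + q - 1)).map C.d).comap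
      (C.F p ⊓ C.G (p + q) ⊓ LinearMap.ker C.d).subtype

/-- `A ⊕ B[1]`, where the shift lowers the second degree of `B` by one. -/
def sumShift (A B : DoubleComplex) : DoubleComplex where
  M := A.M × B.M
  K p q := (A.K p q).prod (B.K p (q + 1))
  d₁ := A.d₁.prodMap B.d₁
  d₂ := A.d₂.prodMap B.d₂
  d₁_mem p q := fun _ hx => ⟨A.d₁_mem _ _ hx.1, B.d₁_mem _ _ hx.2⟩
  d₂_mem p q := fun _ hx => ⟨A.d₂_mem _ _ hx.1, B.d₂_mem _ _ hx.2⟩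
  d₁_sq := by
    ext x
    · exact LinearMap.congr_fun A.d₁_sq x
    · simp
    · simp
    · exact LinearMap.congr_fun B.d₁_sq x
  d₂_sq := by
    ext x
    · exact LinearMap.congr_fun A.d₂_sq x
    · simp
    · simp
    · exact LinearMap.congr_fun B.d₂_sq x
  anticomm := by
    ext x
    · exact LinearMap.congr_fun A.anticomm x
    · simp
    · simp
    · exact LinearMap.congr_fun B.anticomm x

end DoubleComplex

/-! ### The `βγ` system on `ℝ⁴` and its dimensional reduction -/

section Fields

variable (P : Submodule ℝ R4) (V : Type*) [NormedAddCommGroup V] [NormedSpace ℂ V]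

/-- The derivative `∂_v = ∑ v_j ∂/∂x_j` along a complexified translation. -/
def cDeriv (v : CVec) : smoothInv P V →ₗ[ℂ] smoothInv P V :=
  ∑ j, v j • dirDeriv P V (EuclideanSpace.single j (1 : ℝ))

/-- The forms in `Ω^{0,*}(ℂ², V) = C^∞(ℝ⁴, V) ⊗ Λ[dz̄₁, dz̄₂]` whose coefficients are independent of
the directions in `P`: the fields of the dimensional reduction along `P`. The odd generator `dz̄_i`
is `Pi.single i 1`. For `P = ⊥` this is all of `Ω^{0,*}(ℂ², V)`. -/
abbrev Fields : Type _ := Forms P V Spinor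

/-- `∂̄_ε = ∑ dz̄_i (ε₊ ∂/∂z̄_i + ε₋ ε_{ij} ∂/∂z_j)`, acting on the forms independent of `P`
(the derivatives along `P` are automatically zero there). -/
def dbar (ε : Spinor) : Fields P V →ₗ[ℂ] Fields P V :=
  ∑ i : Fin 2, wedgeOp (cDeriv P V (nullVec ε i)) (Pi.single i (1 : ℂ) : Spinor)

/-- The odd generators that occur in `∂̄_ε` after reduction along `P`: the span of the one-forms
`∑ ξ(Γ(ε, s_i)) dz̄_i`, where `ξ` runs through the covectors vanishing on `P`. -/
def symbolSpace (ε : Spinor) : Submodule ℂ Spinor :=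
  (complexify P).dualAnnihilator.map (LinearMap.pi fun i => LinearMap.applyₗ (nullVec ε i))

theorem cDeriv_comm (v w : CVec) :
    cDeriv P V v ∘ₗ cDeriv P V w = cDeriv P V w ∘ₗ cDeriv P V v := by
  have h : ∀ i j : Fin 4, Commute
      (dirDeriv P V (EuclideanSpace.single i (1 : ℝ)) : Module.End ℂ (smoothInv P V))
      (dirDeriv P V (EuclideanSpace.single j (1 : ℝ))) := fun i j => dirDeriv_comm P _ _
  exact (Commute.sum_left _ _ _ fun i _ => Commute.sum_right _ _ _ fun j _ =>
    ((h i j).smul_left (v i)).smul_right (w j)).eq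

theorem dbar_anticomm (ε ε' : Spinor) :
    dbar P V ε ∘ₗ dbar P V ε' + dbar P V ε' ∘ₗ dbar P V ε = 0 := by
  have e : ∀ a b : Spinor, dbar P V a ∘ₗ dbar P V b = ∑ i : Fin 2, ∑ j : Fin 2,
      wedgeOp (cDeriv P V (nullVec a i)) (Pi.single i (1 : ℂ) : Spinor) ∘ₗ
      wedgeOp (cDeriv P V (nullVec b j)) (Pi.single j (1 : ℂ) : Spinor) := by
    intro a b
    exact Finset.sum_mul_sum (R := Module.End ℂ (Fields P V)) _ _ _ _
  rw [e ε ε', e ε' ε, Finset.sum_comm (s := Finset.univ (α := Fin 2)), ← Finset.sum_add_distrib]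
  refine Finset.sum_eq_zero fun i _ => ?_
  rw [← Finset.sum_add_distrib]
  exact Finset.sum_eq_zero fun j _ => wedgeOp_anticomm (cDeriv_comm P V _ _) _ _

theorem dbar_sq (ε : Spinor) : dbar P V ε ∘ₗ dbar P V ε = 0 :=
  comp_self_eq_zero (dbar_anticomm P V ε ε)

theorem dbar_eq (ε : Spinor) :
    ∃ (n : ℕ) (δ : Fin n → smoothInv P V →ₗ[ℂ] smoothInv P V) (θ : Fin n → Spinor),
      (∀ k, θ k ∈ symbolSpace P ε) ∧ dbar P V ε = ∑ k, wedgeOp (δ k) (θ k) := by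
  let u := stdOrthonormalBasis ℝ Pᗮ
  let ξ : Fin (Module.finrank ℝ Pᗮ) → Module.Dual ℂ CVec := fun k =>
    Fintype.linearCombination ℂ (fun j => (((u k : R4) j : ℝ) : ℂ))
  have hξ : ∀ k v, ξ k v = ∑ j, v j * (((u k : R4) j : ℝ) : ℂ) := fun k v => by
    simp [ξ, Fintype.linearCombination_apply]
  have hd : ∀ v : R4, dirDeriv P V v = ∑ k, ((inner ℝ (u k : R4) v : ℝ) : ℂ) •
      dirDeriv P V (u k : R4) := by
    intro v
    ext f x
    have h1 : ∀ w ∈ P, fderiv ℝ f.1 x w = 0 := by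
      intro w hw
      have hf : DifferentiableAt ℝ f.1 x := f.2.1.differentiable (by simp) x
      have hc : (fun t : ℝ => f.1 (x + t • w)) = fun _ => f.1 x :=
        funext fun t => f.2.2 _ (P.smul_mem t hw) x
      have h2 := hf.lineDeriv_eq_fderiv (v := w)
      rw [← h2, lineDeriv, hc, deriv_const]
    have h3 : v = P.starProjection v + ∑ k, (inner ℝ (u k : R4) v : ℝ) • (u k : R4) := by
      have h4 := u.sum_repr (Pᗮ.orthogonalProjectionOnto v)
      have h5 : ∀ k, u.repr (Pᗮ.orthogonalProjectionOnto v) k = inner ℝ (u k : R4) v := by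
        intro k
        rw [u.repr_apply_apply, Submodule.inner_orthogonalProjectionOnto_eq_of_mem_left]
      have h6 : (Pᗮ.starProjection v : R4) = ∑ k, (inner ℝ (u k : R4) v : ℝ) • (u k : R4) := by
        rw [Submodule.starProjection_apply, ← h4]
        simp [h5]
      rw [← h6]
      exact (Submodule.starProjection_add_starProjection_orthogonal (K := P) v).symm
    have h7 : fderiv ℝ f.1 x v = ∑ k, (inner ℝ (u k : R4) v : ℝ) • fderiv ℝ f.1 x (u k : R4) := by
      conv_lhs => rw [h3]
      rw [map_add, h1 _ (Submodule.starProjection_apply_mem P v), zero_add, map_sum]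
      simp
    have h8 : ((∑ k, ((inner ℝ (u k : R4) v : ℝ) : ℂ) • dirDeriv P V (u k : R4)) f).1 x =
        ∑ k, ((inner ℝ (u k : R4) v : ℝ) : ℂ) • fderiv ℝ f.1 x (u k : R4) := by
      simp [LinearMap.sum_apply, Finset.sum_apply, dirDeriv]
    rw [h8]
    change fderiv ℝ f.1 x v = _
    rw [h7]
    exact Finset.sum_congr rfl fun k _ => (Complex.coe_smul _ _).symm
  have hc : ∀ v : CVec, cDeriv P V v = ∑ k, ξ k v • dirDeriv P V (u k : R4) := by
    intro v
    unfold cDeriv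
    have h1 : ∀ j : Fin 4, v j • dirDeriv P V (EuclideanSpace.single j (1 : ℝ)) =
        ∑ k, (v j * (((u k : R4) j : ℝ) : ℂ)) • dirDeriv P V (u k : R4) := by
      intro j
      rw [hd, Finset.smul_sum]
      refine Finset.sum_congr rfl fun k _ => ?_
      rw [smul_smul, EuclideanSpace.inner_single_right]
      simp
    rw [Finset.sum_congr rfl fun j _ => h1 j, Finset.sum_comm]
    refine Finset.sum_congr rfl fun k _ => ?_
    rw [hξ, Finset.sum_smul]
  refine ⟨_, fun k => dirDeriv P V (u k : R4), fun k i => ξ k (nullVec ε i), ?_, ?_⟩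
  · intro k
    refine ⟨ξ k, ?_, rfl⟩
    have hle : complexify P ≤ LinearMap.ker (ξ k) := by
      refine Submodule.span_le.2 ?_
      rintro _ ⟨p, hp, rfl⟩
      have h1 : inner ℝ p (u k : R4) = 0 := (Submodule.mem_orthogonal P _).1 (u k).2 p hp
      change ξ k _ = 0
      rw [hξ]
      have h2 : ∑ j, (p j : ℝ) * ((u k : R4) j : ℝ) = 0 := by
        rw [← h1]; simp [PiLp.inner_apply, mul_comm]
      exact_mod_cast h2
    exact (Submodule.mem_dualAnnihilator _).2 fun w hw => hle hw
  · refine TensorProduct.ext' fun f l => ?_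
    have hθ : ∀ k, (ExteriorAlgebra.ι ℂ (fun i => ξ k (nullVec ε i) : Spinor)) =
        ∑ i, ξ k (nullVec ε i) • ExteriorAlgebra.ι ℂ (Pi.single i (1 : ℂ) : Spinor) := by
      intro k
      rw [← Finset.sum_congr rfl fun i _ => map_smul _ _ _, ← map_sum]
      congr 1
      ext j
      simp [Finset.sum_apply, Pi.single_apply]
    simp only [dbar, wedgeOp, LinearMap.sum_apply, TensorProduct.map_tmul, hc, hθ,
      LinearMap.mulLeft_apply, LinearMap.smul_apply, TensorProduct.sum_tmul,
      Finset.sum_mul, TensorProduct.tmul_sum]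
    rw [Finset.sum_comm]
    refine Finset.sum_congr rfl fun k _ => Finset.sum_congr rfl fun i _ => ?_
    rw [smul_mul_assoc, TensorProduct.smul_tmul]

theorem dbar_bidegree (ε : Spinor) {A B : Submodule ℂ Spinor} {p q p' q' : ℤ}
    (h : (A = symbolSpace P ε ∧ p' = p + 1 ∧ q' = q) ∨
      (B = symbolSpace P ε ∧ p' = p ∧ q' = q + 1)) :
    bidegree P V A B p q ≤ (bidegree P V A B p' q').comap (dbar P V ε) := by
  obtain ⟨n, δ, θ, hθ, he⟩ := dbar_eq P V ε
  intro x hx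
  rw [Submodule.mem_comap, he, LinearMap.sum_apply]
  refine Submodule.sum_mem _ fun k _ => wedgeOp_bidegree (δ k) ?_ hx
  rcases h with ⟨rfl, h⟩ | ⟨rfl, h⟩
  · exact Or.inl ⟨hθ k, h⟩
  · exact Or.inr ⟨hθ k, h⟩

/-- The reduction along `P` as a double complex, for the deformation of the supercharge `a` in the
direction of the supercharge `b`: the differentials are `∂̄_b` (bidegree `(1,0)`) and `∂̄_a`
(bidegree `(0,1)`), the total differential is `∂̄_{a+b}`, and the bidegree counts the odd generators
occurring in `∂̄_b` and in `∂̄_a`. -/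
def reduction (a b : Spinor) : DoubleComplex where
  M := Fields P V
  K := bidegree P V (symbolSpace P b) (symbolSpace P a)
  d₁ := dbar P V b
  d₂ := dbar P V a
  d₁_mem _ _ := dbar_bidegree P V b (Or.inl ⟨rfl, rfl, rfl⟩)
  d₂_mem _ _ := dbar_bidegree P V a (Or.inr ⟨rfl, rfl, rfl⟩)
  d₁_sq := dbar_sq P V b
  d₂_sq := dbar_sq P V a
  anticomm := dbar_anticomm P V b a

/-- The fields `(γ, β)` of the reduced `βγ` system with values in `V`: `γ` takes values in `V` and
`β` in `V^∨[1]` (the constant volume form `d²z` is suppressed). -/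
def bgReduction (a b : Spinor) : DoubleComplex :=
  (reduction P V a b).sumShift (reduction P (V →L[ℂ] ℂ) a b)

/-- The differential of the reduced `βγ` system at the point `ε` of the nilpotence variety. -/
def bgDiff (ε : Spinor) :
    (Fields P V × Fields P (V →L[ℂ] ℂ)) →ₗ[ℂ] (Fields P V × Fields P (V →L[ℂ] ℂ)) :=
  (dbar P V ε).prodMap (dbar P (V →L[ℂ] ℂ) ε)

/-- The Dolbeault complex `Ω^{0,*}(ℝ⁴, J; V)` of a constant complex structure: its odd generators
are the linear forms on `T^{0,1}`, and its differential is `∑ dx_j|_{T^{0,1}} ∂/∂x_j`. -/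
def dolbeault (J : Matrix (Fin 4) (Fin 4) ℝ) :
    Forms (⊥ : Submodule ℝ R4) V (Module.Dual ℂ (T01 J)) →ₗ[ℂ]
      Forms (⊥ : Submodule ℝ R4) V (Module.Dual ℂ (T01 J)) :=
  ∑ j : Fin 4, wedgeOp (dirDeriv ⊥ V (EuclideanSpace.single j (1 : ℝ)))
    ((LinearMap.proj j : CVec →ₗ[ℂ] ℂ) ∘ₗ (T01 J).subtype)

/-! ### The forms on `ℂ` and the Hodge-to-de Rham spectral sequence -/

/-- `Ω^{*,*}(ℂ, V) = C^∞(ℂ, V) ⊗ Λ[dz, dz̄]`. -/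
abbrev OmegaC : Type _ := Forms (⊥ : Submodule ℝ ℂ) V (ℂ × ℂ)

/-- The generator `dz`. -/
def dz : ℂ × ℂ := (1, 0)

/-- The generator `dz̄`. -/
def dzbar : ℂ × ℂ := (0, 1)

/-- `∂ = dz ∧ ∂/∂z`, with `∂/∂z = (∂/∂x - i ∂/∂y) / 2`. -/
def del : OmegaC V →ₗ[ℂ] OmegaC V :=
  wedgeOp ((1 / 2 : ℂ) • dirDeriv ⊥ V (1 : ℂ) + (-(Complex.I / 2)) • dirDeriv ⊥ V Complex.I) dz

/-- `∂̄ = dz̄ ∧ ∂/∂z̄`, with `∂/∂z̄ = (∂/∂x + i ∂/∂y) / 2`. -/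
def delbar : OmegaC V →ₗ[ℂ] OmegaC V :=
  wedgeOp ((1 / 2 : ℂ) • dirDeriv ⊥ V (1 : ℂ) + (Complex.I / 2) • dirDeriv ⊥ V Complex.I) dzbar

theorem wirtinger_comm (a b a' b' : ℂ) :
    (a • dirDeriv ⊥ V (1 : ℂ) + b • dirDeriv ⊥ V Complex.I) ∘ₗ
      (a' • dirDeriv ⊥ V (1 : ℂ) + b' • dirDeriv ⊥ V Complex.I) =
    (a' • dirDeriv ⊥ V (1 : ℂ) + b' • dirDeriv ⊥ V Complex.I) ∘ₗ
      (a • dirDeriv ⊥ V (1 : ℂ) + b • dirDeriv ⊥ V Complex.I) := by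
  have h : Commute (dirDeriv ⊥ V (1 : ℂ) : Module.End ℂ (smoothInv (⊥ : Submodule ℝ ℂ) V))
      (dirDeriv ⊥ V Complex.I) := dirDeriv_comm ⊥ _ _
  have h1 : ∀ c d : ℂ, Commute
      (c • dirDeriv ⊥ V (1 : ℂ) : Module.End ℂ (smoothInv (⊥ : Submodule ℝ ℂ) V))
      (d • dirDeriv ⊥ V Complex.I) := fun c d => (h.smul_left c).smul_right d
  have h2 : ∀ (u : ℂ) (c d : ℂ), Commute
      (c • dirDeriv ⊥ V u : Module.End ℂ (smoothInv (⊥ : Submodule ℝ ℂ) V))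
      (d • dirDeriv ⊥ V u) := fun u c d => ((Commute.refl _).smul_left c).smul_right d
  exact (((h2 1 a a').add_right (h1 a b')).add_left
    (((h1 a' b).symm).add_right (h2 Complex.I b b'))).eq

/-- The double complex `(Ω^{p,q}(ℂ, V), ∂, ∂̄)`. Its spectral sequence is the Hodge-to-de Rham
spectral sequence. -/
def hodge : DoubleComplex where
  M := OmegaC V
  K := bidegree ⊥ V (Submodule.span ℂ {dz}) (Submodule.span ℂ {dzbar})
  d₁ := del V
  d₂ := delbar V
  d₁_mem _ _ := wedgeOp_bidegree _ (Or.inl ⟨Submodule.mem_span_singleton_self _, rfl, rfl⟩)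
  d₂_mem _ _ := wedgeOp_bidegree _ (Or.inr ⟨Submodule.mem_span_singleton_self _, rfl, rfl⟩)
  d₁_sq := comp_self_eq_zero (wedgeOp_anticomm rfl _ _)
  d₂_sq := comp_self_eq_zero (wedgeOp_anticomm rfl _ _)
  anticomm := by
    refine wedgeOp_anticomm ?_ _ _
    have h := wirtinger_comm V (1 / 2) (-(Complex.I / 2)) (1 / 2) (Complex.I / 2)
    exact h

/-- `Ω^{*,*}(ℂ, V) ⊕ Ω^{*,*}(ℂ, V^∨)[1]` with its Hodge bigrading and differentials `∂`, `∂̄`. -/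
def bgHodge : DoubleComplex := (hodge V).sumShift (hodge (V →L[ℂ] ℂ))

/-- The differential `x ∂̄ + y ∂` on `Ω^{*,*}(ℂ, V) ⊕ Ω^{*,*}(ℂ, V^∨)[1]`. -/
def bgHodgeDiff (x y : ℂ) :
    (OmegaC V × OmegaC (V →L[ℂ] ℂ)) →ₗ[ℂ] (OmegaC V × OmegaC (V →L[ℂ] ℂ)) :=
  (x • delbar V + y • del V).prodMap (x • delbar (V →L[ℂ] ℂ) + y • del (V →L[ℂ] ℂ))

/-- The map `Ω^{*,*}(ℂ, V) ⊕ Ω^{*,*}(ℂ, V^∨)[1] → (γ, β)`-fields independent of `P`, given by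
pull-back of functions along `w` and the substitution `h` of `dz, dz̄` by combinations of
`dz̄₁, dz̄₂`. -/
def bgPull (w : R4 →L[ℝ] ℂ) (hw : ∀ v ∈ P, w v = 0) (h : (ℂ × ℂ) →ₗ[ℂ] Spinor) :
    (OmegaC V × OmegaC (V →L[ℂ] ℂ)) →ₗ[ℂ] (Fields P V × Fields P (V →L[ℂ] ℂ)) :=
  (pullForms P V w hw h).prodMap (pullForms P (V →L[ℂ] ℂ) w hw h)

end Fields

end BetaGamma

end

noncomputable section

namespace BetaGamma

/-! Everything rests on one identity. `Γ` identifies `S₊ ⊗ S₋` with `ℂ⁴`, and under it the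
complexified Euclidean form becomes `-1/2` times the product of the two spinor determinants
(`pairing_gam`). Hence `{Q,Q} = 2Γ(Q₊,Q₋)` vanishes only if one factor does, each `Γ(ε,S₋)` with `ε
≠ 0` is a null plane, and every null vector has the form `Γ(a,s)` (`exists_gam_eq`). The orthogonal
complex structures of the standard orientation are the left multiplications by unit imaginary
quaternions (`exists_eq_quaternionMatrix`), and `ε ↦ J_ε` is the Hopf map onto this 2-sphere.

A real plane `P` is cut out by a null covector `n = u₀ + i u₁` and its conjugate, where `u` is an
orthonormal basis of the orthogonal complement (`exists_isNullConormal`). Write `n = Γ(a,s)` and `n̄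
= Γ(b,t)`. Since `(n,n̄) ≠ 0`, both `a, b` and `s, t` are bases. A vector `Γ(ε,x)` lies in `P_ℂ` iff
`(a∧ε)(s∧x) = 0 = (b∧ε)(t∧x)`, so `Γ(ε,S₋)` meets `P_ℂ` in a line when `ε ≠ 0` is a multiple of `a`
or `b`, and trivially for all other nonzero `ε`.

Let `w` be `n`, viewed as a real linear map `ℝ⁴ → ℂ`. As `n` kills `Γ(a,S₋)` and `n̄` kills
`Γ(b,S₋)`, on functions pulled back along `w` the operator `∂̄_a` involves only `∂/∂z̄` and `∂̄_b`
only `∂/∂z` (`cDeriv_pullFun`). The substitution `oddMap` matches their symbols with `dz̄` and `dz`,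
and linearity of `∂̄_ε` in `ε` makes the same map work for every `xa + yb`.

This map also matches bidegrees, so it is an isomorphism of double complexes and acts on all pages
(`exists_pageEquiv`). The first page is computed for any internally bigraded double complex
(`exists_H₂_equiv_page_one`). As `dz` is the only generator of first degree, the filtration has two
steps, and every page from the second on is `gr H` (`exists_grH_equiv_page`). -/

/-- Subspaces `S ≤ T` induce an isomorphism of subquotients when they have the same trace of
relations and `T` is generated by `S` modulo relations. -/
theorem exists_subquotient_equiv {M : Type*} [AddCommGroup M] [Module ℂ M]
    {S T R R' : Submodule ℂ M} (hS : S ≤ T) (hT : T ≤ S ⊔ R') (hR : ∀ x ∈ S, x ∈ R ↔ x ∈ R') :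
    ∃ ψ : (S ⧸ R.comap S.subtype) ≃ₗ[ℂ] (T ⧸ R'.comap T.subtype),
      ∀ (x : S) (z : T), z.1 = x.1 →
        ψ (Submodule.Quotient.mk x) = Submodule.Quotient.mk z := by
  let f : (S ⧸ R.comap S.subtype) →ₗ[ℂ] (T ⧸ R'.comap T.subtype) :=
    Submodule.mapQ _ _ (Submodule.inclusion hS) fun x hx => (hR x.1 x.2).1 hx
  have hinj : Function.Injective f := by
    rw [← LinearMap.ker_eq_bot, LinearMap.ker_eq_bot']
    intro y
    refine Submodule.Quotient.induction_on _ y fun x hx => ?_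
    refine (Submodule.Quotient.mk_eq_zero _).2 ((hR x.1 x.2).2 ?_)
    exact (Submodule.Quotient.mk_eq_zero (R'.comap T.subtype)).1 hx
  have hsurj : Function.Surjective f := by
    intro y
    refine Submodule.Quotient.induction_on _ y fun z => ?_
    obtain ⟨s, hs, r, hr, hz⟩ := Submodule.mem_sup.1 (hT z.2)
    refine ⟨Submodule.Quotient.mk ⟨s, hs⟩, (Submodule.Quotient.eq _).2 ?_⟩
    change s - z.1 ∈ R'
    rw [← hz]
    simpa using hr
  refine ⟨LinearEquiv.ofBijective f ⟨hinj, hsurj⟩, fun x z h => ?_⟩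
  change Submodule.Quotient.mk (Submodule.inclusion hS x) = _
  congr 1
  exact Subtype.ext h.symm

/-! ### Spectral sequences of double complexes: transport, first page, convergence. -/

namespace DoubleComplex

section Iso

variable {C D : DoubleComplex} (Φ : C.M ≃ₗ[ℂ] D.M)

theorem map_K (hK : ∀ p q x, x ∈ C.K p q ↔ Φ x ∈ D.K p q) (p q : ℤ) :
    (C.K p q).map Φ.toLinearMap = D.K p q := by
  ext y
  rw [Submodule.mem_map]
  refine ⟨?_, fun hy => ⟨Φ.symm y, (hK _ _ _).2 (by simpa using hy), by simp⟩⟩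
  rintro ⟨x, hx, rfl⟩
  exact (hK _ _ _).1 hx

theorem mem_iff_of_map_eq {S : Submodule ℂ C.M} {T : Submodule ℂ D.M}
    (h : S.map Φ.toLinearMap = T) (x : C.M) : Φ x ∈ T ↔ x ∈ S := by
  rw [← h]
  refine ⟨?_, fun hx => ⟨x, hx, rfl⟩⟩
  rintro ⟨y, hy, hxy⟩
  exact Φ.injective hxy ▸ hy

theorem map_eq_of_mem_iff {S : Submodule ℂ C.M} {T : Submodule ℂ D.M}
    (h : ∀ x, Φ x ∈ T ↔ x ∈ S) : S.map Φ.toLinearMap = T := by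
  ext y
  refine ⟨?_, fun hy => ⟨Φ.symm y, (h _).1 (by simpa using hy), by simp⟩⟩
  rintro ⟨x, hx, rfl⟩
  exact (h x).2 hx

theorem map_F (hK : ∀ p q x, x ∈ C.K p q ↔ Φ x ∈ D.K p q) (p : ℤ) :
    (C.F p).map Φ.toLinearMap = D.F p := by
  simp only [F, Submodule.map_iSup, map_K Φ hK]

theorem isInternal_of_equiv (hK : ∀ p q x, x ∈ C.K p q ↔ Φ x ∈ D.K p q)
    (hC : DirectSum.IsInternal fun pq : ℤ × ℤ => C.K pq.1 pq.2) :
    DirectSum.IsInternal fun pq : ℤ × ℤ => D.K pq.1 pq.2 := by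
  have h : ∀ pq : ℤ × ℤ, D.K pq.1 pq.2 = (C.K pq.1 pq.2).map Φ.toLinearMap := fun pq =>
    (map_K Φ hK pq.1 pq.2).symm
  refine DirectSum.isInternal_submodule_of_iSupIndep_of_iSup_eq_top ?_ ?_
  · simp only [h]
    exact LinearMap.iSupIndep_map _ Φ.injective hC.submodule_iSupIndep
  · simp only [h]
    rw [← Submodule.map_iSup, hC.submodule_iSup_eq_top, Submodule.map_top]
    exact Φ.range

theorem map_G (hK : ∀ p q x, x ∈ C.K p q ↔ Φ x ∈ D.K p q) (n : ℤ) :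
    (C.G n).map Φ.toLinearMap = D.G n := by
  simp only [G, Submodule.map_iSup, map_K Φ hK]

/-- `Z` and `B` are built from `F`, `G` and `d` by intersections, sums, images and preimages, so an
isomorphism respecting these data carries them along. -/
theorem map_Z (hK : ∀ p q x, x ∈ C.K p q ↔ Φ x ∈ D.K p q) (hd : ∀ x, D.d (Φ x) = Φ (C.d x))
    (r p q : ℤ) : (C.Z r p q).map Φ.toLinearMap = D.Z r p q := by
  refine map_eq_of_mem_iff Φ fun x => ?_
  simp only [Z, Submodule.mem_inf, Submodule.mem_comap, hd,
    mem_iff_of_map_eq Φ (map_F Φ hK _), mem_iff_of_map_eq Φ (map_G Φ hK _)]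

theorem map_B (hK : ∀ p q x, x ∈ C.K p q ↔ Φ x ∈ D.K p q) (hd : ∀ x, D.d (Φ x) = Φ (C.d x))
    (r p q : ℤ) : (C.B r p q).map Φ.toLinearMap = D.B r p q := by
  have h : D.d ∘ₗ Φ.toLinearMap = Φ.toLinearMap ∘ₗ C.d := LinearMap.ext hd
  rw [B, B, Submodule.map_sup, map_Z Φ hK hd, ← Submodule.map_comp, ← h, Submodule.map_comp,
    map_Z Φ hK hd]

/-- An isomorphism of double complexes induces isomorphisms of the pages, which commute with the
differentials. -/
theorem exists_pageEquiv (hK : ∀ p q x, x ∈ C.K p q ↔ Φ x ∈ D.K p q)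
    (hd : ∀ x, D.d (Φ x) = Φ (C.d x)) :
    ∃ φ : ∀ (r : ℕ) (p q : ℤ), C.Page r p q ≃ₗ[ℂ] D.Page r p q,
      (∀ (r : ℕ) (p q : ℤ) (z : C.Z r p q) (z' : D.Z r p q),
        z'.1 = Φ z.1 → φ r p q (C.cls r p q z) = D.cls r p q z') ∧
      ∀ (r : ℕ) (p q : ℤ) e, φ r (p + r) (q - r + 1) (C.dr r p q e) =
        D.dr r p q (φ r p q e) := by
  let ζ : ∀ r p q : ℤ, C.Z r p q ≃ₗ[ℂ] D.Z r p q := fun r p q =>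
    Φ.ofSubmodules _ _ (map_Z Φ hK hd r p q)
  have hζ : ∀ r p q z, ((ζ r p q z : D.Z r p q) : D.M) = Φ z.1 := fun r p q z => rfl
  let φ : ∀ (r : ℕ) (p q : ℤ), C.Page r p q ≃ₗ[ℂ] D.Page r p q := fun r p q =>
    Submodule.Quotient.equiv _ _ (ζ r p q) (by
      ext y
      rw [Submodule.mem_map]
      constructor
      · rintro ⟨x, hx, rfl⟩
        exact (mem_iff_of_map_eq Φ (map_B Φ hK hd r p q) x.1).2 hx
      · intro hy
        refine ⟨(ζ r p q).symm y, ?_, (ζ r p q).apply_symm_apply y⟩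
        refine (mem_iff_of_map_eq Φ (map_B Φ hK hd r p q) _).1 ?_
        have e : Φ ((ζ r p q).symm y).1 = y.1 := by rw [← hζ, LinearEquiv.apply_symm_apply]
        exact e.symm ▸ hy)
  have hφ : ∀ (r : ℕ) (p q : ℤ) (z : C.Z r p q) (z' : D.Z r p q),
      z'.1 = Φ z.1 → φ r p q (C.cls r p q z) = D.cls r p q z' := by
    intro r p q z z' h
    change Submodule.Quotient.mk (ζ r p q z) = _
    congr 1
    exact Subtype.ext h.symm
  refine ⟨φ, hφ, fun r p q e => ?_⟩
  refine Submodule.Quotient.induction_on _ e fun z => ?_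
  rw [hφ r p q z (ζ r p q z) rfl]
  exact hφ r _ _ ⟨C.d z.1, C.d_Z r p q z.1 z.2⟩ ⟨D.d (Φ z.1), D.d_Z r p q _ (ζ r p q z).2⟩ (hd _)

end Iso

variable (C : DoubleComplex)

theorem K_le_F {p p' : ℤ} (h : p ≤ p') (q : ℤ) : C.K p' q ≤ C.F p :=
  le_iSup₂_of_le p' h (le_iSup_of_le q le_rfl)

theorem K_le_G (p q : ℤ) : C.K p q ≤ C.G (p + q) :=
  le_iSup_of_le p (by rw [add_sub_cancel_left])

theorem F_anti {p p' : ℤ} (h : p ≤ p') : C.F p' ≤ C.F p :=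
  iSup₂_le fun _ hp => iSup_le fun q => C.K_le_F (h.trans hp) q

theorem d_F (p : ℤ) : C.F p ≤ (C.F p).comap C.d := by
  refine iSup₂_le fun p' hp => iSup_le fun q x hx => ?_
  exact Submodule.add_mem _ (C.K_le_F (by omega) _ (C.d₁_mem _ _ hx))
    (C.K_le_F hp _ (C.d₂_mem _ _ hx))

theorem disjoint_K_F (hC : DirectSum.IsInternal fun pq : ℤ × ℤ => C.K pq.1 pq.2) (p q : ℤ) :
    Disjoint (C.K p q) (C.F (p + 1)) := by
  have h := hC.submodule_iSupIndep (p, q)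
  refine h.mono_right (iSup₂_le fun p' hp => iSup_le fun q' => ?_)
  exact le_iSup₂_of_le (p', q') (by rw [Ne, Prod.mk.injEq]; omega) le_rfl

/-- An element of `F^p` splits into its `K^{p,q}` component, a tail in `F^{p+1}` of the same total
degree, and components of other total degrees. The last part also has total degree `p + q`, so
independence of the bidegrees kills it. -/
theorem F_inf_G_le (hC : DirectSum.IsInternal fun pq : ℤ × ℤ => C.K pq.1 pq.2) (p q : ℤ) :
    C.F p ⊓ C.G (p + q) ≤ C.K p q ⊔ (C.F (p + 1) ⊓ C.G (p + q)) := by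
  rintro x ⟨hF, hG⟩
  have hle : C.F p ≤ (C.K p q ⊔ (C.F (p + 1) ⊓ C.G (p + q))) ⊔
      ⨆ i ∈ {i : ℤ × ℤ | i.1 + i.2 ≠ p + q}, C.K i.1 i.2 := by
    refine iSup₂_le fun p' hp => iSup_le fun q' => ?_
    by_cases hs : p' + q' = p + q
    · refine le_sup_of_le_left ?_
      rcases hp.eq_or_lt with rfl | hp
      · obtain rfl : q' = q := by omega
        exact le_sup_left
      · exact le_sup_of_le_right (le_inf (C.K_le_F hp q') (hs ▸ C.K_le_G p' q'))
    · exact le_sup_of_le_right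
        (le_iSup₂_of_le (f := fun (i : ℤ × ℤ) _ => C.K i.1 i.2) (p', q') hs le_rfl)
  obtain ⟨y, hy, z, hz, rfl⟩ := Submodule.mem_sup.1 (hle hF)
  have hyG : y ∈ C.G (p + q) := by
    have : C.K p q ⊔ (C.F (p + 1) ⊓ C.G (p + q)) ≤ C.G (p + q) :=
      sup_le (C.K_le_G p q) inf_le_right
    exact this hy
  have hzG : z ∈ C.G (p + q) := by simpa using Submodule.sub_mem _ hG hyG
  have hGle : C.G (p + q) ≤ ⨆ i ∈ {i : ℤ × ℤ | i.1 + i.2 = p + q}, C.K i.1 i.2 :=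
    iSup_le fun p' => le_iSup₂_of_le (f := fun (i : ℤ × ℤ) _ => C.K i.1 i.2)
      (p', p + q - p') (by simp) le_rfl
  have hdis := hC.submodule_iSupIndep.disjoint_biSup_biSup
    (s := {i : ℤ × ℤ | i.1 + i.2 = p + q}) (t := {i : ℤ × ℤ | i.1 + i.2 ≠ p + q})
    (Set.disjoint_left.2 fun i hi hi' => hi' hi)
  rw [Submodule.disjoint_def.1 hdis z (hGle hzG) hz, add_zero]
  exact hy

/-- Modulo `F^{p+1}` an element of `Z₁` is its leading component `k` in `K^{p,q}`. As `d₁` raises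
the filtration, `dk ∈ F^{p+1}` only says `d₂ k = 0`, and boundaries likewise reduce to images of
`d₂`. -/
theorem exists_H₂_equiv_page_one (hC : DirectSum.IsInternal fun pq : ℤ × ℤ => C.K pq.1 pq.2)
    (p q : ℤ) : ∃ ψ : C.H₂ p q ≃ₗ[ℂ] C.Page 1 p q,
      ∀ x (z : C.Z 1 p q), z.1 = x.1 → ψ (Submodule.Quotient.mk x) = C.cls 1 p q z := by
  have hker : ∀ k ∈ C.K p q, C.d k ∈ C.F (p + 1) ↔ C.d₂ k = 0 := by
    intro k hk
    have h1 : C.d₁ k ∈ C.F (p + 1) := C.K_le_F le_rfl _ (C.d₁_mem _ _ hk)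
    refine (Submodule.add_mem_iff_right _ h1).trans ⟨fun h2 => ?_, fun h => h ▸ zero_mem _⟩
    exact Submodule.disjoint_def.1 (C.disjoint_K_F hC p (q + 1)) _ (C.d₂_mem _ _ hk) h2
  -- At index `r - 1 = 0` the condition on the differential is automatic, because `d` preserves the
  -- filtration.
  have hZ0 : C.Z (1 - 1) (p + 1) (q - 1) = C.F (p + 1) ⊓ C.G (p + q) := by
    have e : p + 1 + (q - 1) = p + q := by ring
    rw [Z, e, sub_self, add_zero]
    exact inf_eq_left.2 (inf_le_left.trans (C.d_F _))
  refine exists_subquotient_equiv ?_ ?_ ?_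
  · rintro k ⟨hk, hk2⟩
    exact ⟨⟨C.K_le_F le_rfl _ hk, C.K_le_G _ _ hk⟩, (hker k hk).2 hk2⟩
  · rintro z ⟨hz, hdz⟩
    obtain ⟨k, hk, f, hf, rfl⟩ := Submodule.mem_sup.1 (C.F_inf_G_le hC p q hz)
    refine Submodule.add_mem_sup ⟨hk, ?_⟩ (Submodule.mem_sup_left (hZ0 ▸ hf))
    refine (hker k hk).1 ?_
    have h1 : C.d k + C.d f ∈ C.F (p + 1) := by rw [← map_add]; exact hdz
    exact (Submodule.add_mem_iff_left (C.F (p + 1)) (C.d_F _ hf.1)).1 h1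
  · rintro k ⟨hk, -⟩
    constructor
    · rintro ⟨y, hy, rfl⟩
      have hdy : C.d₁ y ∈ C.F (p + 1) ⊓ C.G (p + q) := by
        have h1 := C.d₁_mem _ _ hy
        refine ⟨C.K_le_F le_rfl _ h1, ?_⟩
        have e : p + 1 + (q - 1) = p + q := by ring
        rw [← e]
        exact C.K_le_G _ _ h1
      have e : C.d₂ y = -C.d₁ y + C.d y := by simp [d]
      rw [e]
      refine Submodule.add_mem_sup (hZ0 ▸ neg_mem hdy) ⟨y, ?_, rfl⟩
      have e1 : p - 1 + 1 = p := by ring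
      have e2 : q + 1 - 2 = q - 1 := by ring
      rw [e1, e2, sub_self, Z, add_zero]
      have hyF := C.K_le_F le_rfl _ hy
      exact ⟨⟨hyF, C.K_le_G _ _ hy⟩, C.d_F _ hyF⟩
    · intro hB
      obtain ⟨f, hf, y', ⟨y, hy, rfl⟩, hfy⟩ := Submodule.mem_sup.1 (show k ∈ C.B 1 p q from hB)
      have e1 : p - 1 + 1 = p := by ring
      have e2 : q + 1 - 2 = q - 1 := by ring
      rw [e1, e2, sub_self] at hy
      obtain ⟨k', hk', f', hf', rfl⟩ := Submodule.mem_sup.1 (C.F_inf_G_le hC p (q - 1) hy.1)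
      refine ⟨k', hk', ?_⟩
      have h2 := C.d₂_mem _ _ hk'
      rw [sub_add_cancel] at h2
      rw [hZ0] at hf
      refine (sub_eq_zero.1 (Submodule.disjoint_def.1 (C.disjoint_K_F hC p q) _
        (Submodule.sub_mem _ hk h2) ?_)).symm
      -- The left side has bidegree `(p,q)` and every term on the right lies in `F^{p+1}`, so both
      -- vanish.
      have e : k - C.d₂ k' = f + C.d₁ k' + C.d f' := by
        rw [← hfy, map_add, d, LinearMap.add_apply]; abel
      rw [e]
      exact Submodule.add_mem _ (Submodule.add_mem _ hf.1
        (C.K_le_F le_rfl _ (C.d₁_mem _ _ hk'))) (C.d_F _ hf'.1)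

/-- If the first degree takes only the values `0` and `1`, the spectral sequence degenerates at
`E₂` and converges to the total cohomology. -/
theorem exists_grH_equiv_page (h0 : C.F 0 = ⊤) (h2 : C.F 2 = ⊥) (r : ℕ) (hr : 2 ≤ r) (p q : ℤ) :
    ∃ ψ : C.GrH p q ≃ₗ[ℂ] C.Page r p q,
      ∀ x (z : C.Z r p q), z.1 = x.1 → ψ (Submodule.Quotient.mk x) = C.cls r p q z := by
  have htop : ∀ p ≤ 0, C.F p = ⊤ := fun p hp => top_le_iff.1 (h0 ▸ C.F_anti hp)
  have hbot : ∀ p, 2 ≤ p → C.F p = ⊥ := fun p hp => le_bot_iff.1 (h2 ▸ C.F_anti hp)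
  have hr' : (2 : ℤ) ≤ r := by exact_mod_cast hr
  have hZ1 : C.Z (r - 1) (p + 1) (q - 1) =
      C.F (p + 1) ⊓ C.G (p + q) ⊓ (C.F (p + r)).comap C.d := by
    have e : p + 1 + (q - 1) = p + q := by ring
    have e' : p + 1 + ((r : ℤ) - 1) = p + r := by ring
    rw [Z, e, e']
  have hZ2 : C.Z (r - 1) (p - r + 1) (q + r - 2) =
      C.F (p - r + 1) ⊓ C.G (p + q - 1) ⊓ (C.F p).comap C.d := by
    have e : p - r + 1 + (q + r - 2) = p + q - 1 := by ring
    have e' : p - (r : ℤ) + 1 + ((r : ℤ) - 1) = p := by ring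
    rw [Z, e, e']
  have hker : LinearMap.ker C.d ≤ (C.F (p + r)).comap C.d := fun x hx => by
    rw [Submodule.mem_comap, LinearMap.mem_ker.1 hx]; exact zero_mem _
  refine exists_subquotient_equiv (inf_le_inf_left _ hker) ?_ ?_
  -- For `p < 0`, `F^{p+1}` is everything, so `Z_r` already consists of relations. For `p ≥ 0`, `p +
  -- r ≥ 2` gives `F^{p+r} = 0`, so `Z_r` consists of cocycles.
  · rcases lt_or_ge p 0 with hp | hp
    · refine le_sup_of_le_right (le_sup_of_le_left ?_)
      rw [hZ1, htop (p + 1) (by omega)]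
      exact inf_le_inf_right _ (inf_le_inf_right _ le_top)
    · refine le_sup_of_le_left ?_
      rw [Z, hbot (p + r) (by omega)]
      exact le_rfl
  · rintro x ⟨⟨hxF, hxG⟩, hx⟩
    rw [B, hZ1, hZ2]
    constructor
    · intro h
      obtain ⟨f, hf, y', ⟨y, hy, rfl⟩, rfl⟩ := Submodule.mem_sup.1 h
      -- The cochain `y` must lie in `F^{p-r+1}`. This is automatic for `p ≤ 1`, since then `p - r +
      -- 1 ≤ 0`; for `p ≥ 2` the class is zero because `F^p = 0`.
      rcases lt_or_ge 1 p with hp | hp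
      · have h0 : f + C.d y = 0 := by rw [hbot p (by omega)] at hxF; exact hxF
        rw [h0]; exact zero_mem _
      · refine Submodule.add_mem_sup ⟨hf.1, hker hf.2⟩ ⟨y, ⟨⟨?_, hy⟩, ?_⟩, rfl⟩
        · rw [htop _ (by omega)]; trivial
        · have := Submodule.sub_mem _ hxF (C.F_anti (by omega : p ≤ p + 1) hf.1.1)
          simpa using this
    · intro h
      rcases lt_or_ge p 0 with hp | hp
      · refine Submodule.mem_sup_left ⟨⟨?_, hxG⟩, hx⟩
        rw [htop _ (by omega)]; trivial
      · obtain ⟨f, hf, y', ⟨y, hy, rfl⟩, rfl⟩ := Submodule.mem_sup.1 h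
        refine Submodule.add_mem_sup ⟨hf.1, ?_⟩ ⟨y, hy.1.2, rfl⟩
        have := hf.2
        rwa [hbot (p + r) (by omega)] at this

theorem sumShift_iSupIndep {A B : DoubleComplex}
    (hA : iSupIndep fun pq : ℤ × ℤ => A.K pq.1 pq.2)
    (hB : iSupIndep fun pq : ℤ × ℤ => B.K pq.1 pq.2) :
    iSupIndep fun pq : ℤ × ℤ => (A.sumShift B).K pq.1 pq.2 := by
  intro i
  rw [Submodule.disjoint_def]
  intro x hx hx'
  have h1 : x.1 = 0 := by
    refine Submodule.disjoint_def.1 (hA i) _ hx.1 ?_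
    have h : ⨆ (j : ℤ × ℤ) (_ : j ≠ i), (A.sumShift B).K j.1 j.2 ≤
        (⨆ (j : ℤ × ℤ) (_ : j ≠ i), A.K j.1 j.2).comap (LinearMap.fst ℂ A.M B.M) :=
      iSup₂_le fun j hj y hy =>
        le_iSup₂_of_le (f := fun (j : ℤ × ℤ) (_ : j ≠ i) => A.K j.1 j.2) j hj le_rfl hy.1
    exact h hx'
  have h2 : x.2 = 0 := by
    refine Submodule.disjoint_def.1 (hB (i.1, i.2 + 1)) _ hx.2 ?_
    have h : ⨆ (j : ℤ × ℤ) (_ : j ≠ i), (A.sumShift B).K j.1 j.2 ≤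
        (⨆ (j : ℤ × ℤ) (_ : j ≠ (i.1, i.2 + 1)), B.K j.1 j.2).comap
          (LinearMap.snd ℂ A.M B.M) := by
      refine iSup₂_le fun j hj y hy =>
        le_iSup₂_of_le (f := fun (j : ℤ × ℤ) (_ : j ≠ (i.1, i.2 + 1)) => B.K j.1 j.2)
          (j.1, j.2 + 1) ?_ le_rfl hy.2
      rw [Ne, Prod.ext_iff] at hj ⊢
      simpa using hj
    exact h hx'
  exact Prod.ext h1 h2

theorem sumShift_iSup_eq_top {A B : DoubleComplex}
    (hA : ⨆ pq : ℤ × ℤ, A.K pq.1 pq.2 = ⊤) (hB : ⨆ pq : ℤ × ℤ, B.K pq.1 pq.2 = ⊤) :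
    ⨆ pq : ℤ × ℤ, (A.sumShift B).K pq.1 pq.2 = ⊤ := by
  have h1 : (⊤ : Submodule ℂ A.M) ≤
      (⨆ pq : ℤ × ℤ, (A.sumShift B).K pq.1 pq.2).comap (LinearMap.inl ℂ A.M B.M) := by
    rw [← hA]
    exact iSup_le fun i x hx => Submodule.mem_iSup_of_mem i ⟨hx, zero_mem _⟩
  have h2 : (⊤ : Submodule ℂ B.M) ≤
      (⨆ pq : ℤ × ℤ, (A.sumShift B).K pq.1 pq.2).comap (LinearMap.inr ℂ A.M B.M) := by
    rw [← hB]
    refine iSup_le fun i x hx => Submodule.mem_iSup_of_mem (i.1, i.2 - 1) ⟨zero_mem _, ?_⟩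
    change x ∈ B.K i.1 (i.2 - 1 + 1)
    rwa [sub_add_cancel]
  refine top_le_iff.1 fun x _ => ?_
  have h := Submodule.add_mem (⨆ pq : ℤ × ℤ, (A.sumShift B).K pq.1 pq.2) (h1 (Submodule.mem_top (x := x.1)))
    (h2 (Submodule.mem_top (x := x.2)))
  have e : LinearMap.inl ℂ A.M B.M x.1 + LinearMap.inr ℂ A.M B.M x.2 = x :=
    Prod.ext (add_zero _) (zero_add _)
  exact Eq.mp (congrArg (· ∈ ⨆ pq : ℤ × ℤ, (A.sumShift B).K pq.1 pq.2) e) h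

end DoubleComplex

/-! ### The bigrading of the exterior algebra. -/

section Odd

variable {T : Type*} [AddCommGroup T] [Module ℂ T]
variable {T' : Type*} [AddCommGroup T'] [Module ℂ T']

theorem map_bigraded (h : T' →ₗ[ℂ] T) (A B : Submodule ℂ T') (m n : ℕ) :
    ((A.map (ExteriorAlgebra.ι ℂ)) ^ m * (B.map (ExteriorAlgebra.ι ℂ)) ^ n).map
        (ExteriorAlgebra.map h).toLinearMap =
      ((A.map h).map (ExteriorAlgebra.ι ℂ)) ^ m * ((B.map h).map (ExteriorAlgebra.ι ℂ)) ^ n := by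
  rw [Submodule.map_mul, Submodule.map_pow, Submodule.map_pow]
  simp only [← Submodule.map_comp, ExteriorAlgebra.map_comp_ι]

/-- The sum `U` contains `1` and is stable under left multiplication by generators from `A` and from
`B`, hence by all generators. By induction it contains every exterior power. -/
theorem iSup_bigraded_eq_top {A B : Submodule ℂ T} (hAB : A ⊔ B = ⊤) :
    ⨆ k : ℕ × ℕ, (A.map (ExteriorAlgebra.ι ℂ)) ^ k.1 * (B.map (ExteriorAlgebra.ι ℂ)) ^ k.2 =
      ⊤ := by
  set U := ⨆ k : ℕ × ℕ,
    (A.map (ExteriorAlgebra.ι ℂ)) ^ k.1 * (B.map (ExteriorAlgebra.ι ℂ)) ^ k.2 with hU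
  have hle : ∀ m n : ℕ, (A.map (ExteriorAlgebra.ι ℂ)) ^ m * (B.map (ExteriorAlgebra.ι ℂ)) ^ n ≤
      U := fun m n => le_iSup (fun k : ℕ × ℕ =>
        (A.map (ExteriorAlgebra.ι ℂ)) ^ k.1 * (B.map (ExteriorAlgebra.ι ℂ)) ^ k.2) (m, n)
  have hA : A.map (ExteriorAlgebra.ι ℂ) * U ≤ U := by
    rw [hU, Submodule.mul_iSup]
    refine iSup_le fun k => ?_
    rw [← mul_assoc, ← pow_succ']
    exact hle _ _
  have hB : B.map (ExteriorAlgebra.ι ℂ) * U ≤ U := by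
    rw [hU, Submodule.mul_iSup]
    refine iSup_le fun k => ?_
    rw [← mul_assoc, ← ((map_ι_comm A B).pow_left _).eq, mul_assoc, ← pow_succ']
    exact hle _ _
  have hn : ∀ n : ℕ, (⋀[ℂ]^n T : Submodule ℂ (ExteriorAlgebra ℂ T)) ≤ U := by
    intro n
    induction n with
    | zero => simpa using hle 0 0
    | succ n ih =>
      have e : LinearMap.range (ExteriorAlgebra.ι ℂ : T →ₗ[ℂ] _) =
          A.map (ExteriorAlgebra.ι ℂ) ⊔ B.map (ExteriorAlgebra.ι ℂ) := by
        rw [← Submodule.map_sup, hAB, Submodule.map_top]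
      change LinearMap.range (ExteriorAlgebra.ι ℂ : T →ₗ[ℂ] _) ^ (n + 1) ≤ U
      rw [pow_succ']
      refine (mul_le_mul_right ih _).trans ?_
      rw [e, Submodule.sup_mul]
      exact sup_le hA hB
  rw [← top_le_iff, ← (DirectSum.Decomposition.isInternal
    (fun n : ℕ => (⋀[ℂ]^n T : Submodule ℂ (ExteriorAlgebra ℂ T)))).submodule_iSup_eq_top]
  exact iSup_le hn

theorem eigenspace_pow_le {R : Type*} [Ring R] [Algebra ℂ R] (g : R →ₐ[ℂ] R) {S : Submodule ℂ R}
    {μ : ℂ} (hS : S ≤ Module.End.eigenspace g.toLinearMap μ) (n : ℕ) :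
    S ^ n ≤ Module.End.eigenspace g.toLinearMap (μ ^ n) := by
  induction n with
  | zero =>
    rw [pow_zero, pow_zero, Submodule.one_le, Module.End.mem_eigenspace_iff]
    simp
  | succ n ih =>
    rw [pow_succ, Submodule.mul_le]
    intro x hx y hy
    have h1 : g x = μ ^ n • x := Module.End.mem_eigenspace_iff.1 (ih hx)
    have h2 : g y = μ • y := Module.End.mem_eigenspace_iff.1 (hS hy)
    rw [Module.End.mem_eigenspace_iff, AlgHom.toLinearMap_apply, map_mul, h1, h2, pow_succ]
    simp [smul_smul, mul_comm]

end Odd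

/-- The exponents are recovered by the 2-adic and 3-adic valuations. Consequently the single
operator scaling generators from `A` by 2 and from `B` by 3 separates all bidegrees by its
eigenvalues. -/
theorem two_zpow_mul_three_zpow_injective :
    Function.Injective fun k : ℤ × ℤ => (2 : ℂ) ^ k.1 * (3 : ℂ) ^ k.2 := by
  intro k l h
  have h' : ((2 : ℕ) : ℚ) ^ k.1 * ((3 : ℕ) : ℚ) ^ k.2 =
      ((2 : ℕ) : ℚ) ^ l.1 * ((3 : ℕ) : ℚ) ^ l.2 := by
    have h1 : ((((2 : ℕ) : ℚ) ^ k.1 * ((3 : ℕ) : ℚ) ^ k.2 : ℚ) : ℂ) =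
      ((((2 : ℕ) : ℚ) ^ l.1 * ((3 : ℕ) : ℚ) ^ l.2 : ℚ) : ℂ) := by
      push_cast
      exact h
    exact_mod_cast h1
  have : Fact (Nat.Prime 2) := ⟨Nat.prime_two⟩
  have : Fact (Nat.Prime 3) := ⟨Nat.prime_three⟩
  have h23 : padicValRat 2 ((3 : ℕ) : ℚ) = 0 := by
    rw [padicValRat.of_nat, padicValNat_primes (by norm_num)]; rfl
  have h32 : padicValRat 3 ((2 : ℕ) : ℚ) = 0 := by
    rw [padicValRat.of_nat, padicValNat_primes (by norm_num)]; rfl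
  have n2 : ((2 : ℕ) : ℚ) ≠ 0 := by norm_num
  have n3 : ((3 : ℕ) : ℚ) ≠ 0 := by norm_num
  have key2 : ∀ i j : ℤ, padicValRat 2 (((2 : ℕ) : ℚ) ^ i * ((3 : ℕ) : ℚ) ^ j) = i := by
    intro i j
    rw [padicValRat.mul (zpow_ne_zero _ n2) (zpow_ne_zero _ n3), padicValRat.zpow,
      padicValRat.zpow, h23, padicValRat.self (by norm_num)]
    simp
  have key3 : ∀ i j : ℤ, padicValRat 3 (((2 : ℕ) : ℚ) ^ i * ((3 : ℕ) : ℚ) ^ j) = j := by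
    intro i j
    rw [padicValRat.mul (zpow_ne_zero _ n2) (zpow_ne_zero _ n3), padicValRat.zpow,
      padicValRat.zpow, h32, padicValRat.self (by norm_num)]
    simp
  exact Prod.ext (by rw [← key2 k.1 k.2, h', key2]) (by rw [← key3 k.1 k.2, h', key3])

theorem iSupIndep_of_eigenvalues {M : Type*} [AddCommGroup M] [Module ℂ M] (f : M →ₗ[ℂ] M)
    (K : ℤ × ℤ → Submodule ℂ M)
    (hK : ∀ k, ∀ x ∈ K k, f x = ((2 : ℂ) ^ k.1 * (3 : ℂ) ^ k.2) • x) : iSupIndep K :=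
  ((Module.End.eigenspaces_iSupIndep f).comp two_zpow_mul_three_zpow_injective).mono
    fun k x hx => Module.End.mem_eigenspace_iff.2 (hK k x hx)

/-! ### Forms of a given bidegree. -/

section Bidegree

variable {E : Type*} [NormedAddCommGroup E] [NormedSpace ℝ E]
variable (P : Submodule ℝ E) (V : Type*) [NormedAddCommGroup V] [NormedSpace ℂ V]
variable {T : Type*} [AddCommGroup T] [Module ℂ T]

/-- The subspaces of bidegree `(p, q)` are independent as soon as the generators from `A` and `B`
can be scaled independently. -/
theorem iSupIndep_bidegree (A B : Submodule ℂ T) (σ : T →ₗ[ℂ] T) (hA : ∀ a ∈ A, σ a = (2 : ℂ) • a)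
    (hB : ∀ b ∈ B, σ b = (3 : ℂ) • b) :
    iSupIndep fun pq : ℤ × ℤ => bidegree P V A B pq.1 pq.2 := by
  let g := ExteriorAlgebra.map σ
  let f : Forms P V T →ₗ[ℂ] Forms P V T := TensorProduct.map LinearMap.id g.toLinearMap
  have hg : ∀ (C : Submodule ℂ T) (μ : ℂ), (∀ c ∈ C, σ c = μ • c) →
      C.map (ExteriorAlgebra.ι ℂ) ≤ Module.End.eigenspace g.toLinearMap μ := by
    rintro C μ hC _ ⟨c, hc, rfl⟩
    rw [Module.End.mem_eigenspace_iff, AlgHom.toLinearMap_apply, ExteriorAlgebra.map_apply_ι,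
      hC c hc, map_smul]
  refine iSupIndep_of_eigenvalues (M := Forms P V T) f _ ?_
  rintro ⟨p, q⟩
  change bidegree P V A B p q ≤ LinearMap.eqLocus f (((2 : ℂ) ^ p * (3 : ℂ) ^ q) • LinearMap.id)
  unfold bidegree
  split_ifs with hpq
  · obtain ⟨m, rfl⟩ := Int.eq_ofNat_of_zero_le hpq.1
    obtain ⟨n, rfl⟩ := Int.eq_ofNat_of_zero_le hpq.2
    rw [Submodule.map₂_le]
    intro x _ l hl
    have hl' : g l = ((2 : ℂ) ^ m * (3 : ℂ) ^ n) • l := by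
      refine Submodule.mul_induction_on hl ?_ ?_
      · intro a ha b hb
        have h1 : g a = (2 : ℂ) ^ m • a :=
          Module.End.mem_eigenspace_iff.1 (eigenspace_pow_le g (hg A 2 hA) m ha)
        have h2 : g b = (3 : ℂ) ^ n • b :=
          Module.End.mem_eigenspace_iff.1 (eigenspace_pow_le g (hg B 3 hB) n hb)
        rw [map_mul, h1, h2, smul_mul_smul_comm]
      · intro a b ha hb
        rw [map_add, ha, hb, smul_add]
    rw [LinearMap.mem_eqLocus]
    simp only [f, LinearMap.smul_apply, TensorProduct.mk_apply, TensorProduct.map_tmul, LinearMap.id_apply,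
      AlgHom.toLinearMap_apply, hl', TensorProduct.tmul_smul, zpow_natCast]
  · exact bot_le

theorem iSup_bidegree_eq_top {A B : Submodule ℂ T} (hAB : A ⊔ B = ⊤) :
    ⨆ pq : ℤ × ℤ, bidegree P V A B pq.1 pq.2 = ⊤ := by
  rw [← top_le_iff, ← TensorProduct.map₂_mk_top_top_eq_top, ← iSup_bigraded_eq_top hAB,
    Submodule.map₂_iSup_right]
  refine iSup_le fun k => le_iSup_of_le ((k.1 : ℤ), (k.2 : ℤ)) ?_
  rw [bidegree, if_pos ⟨Int.natCast_nonneg _, Int.natCast_nonneg _⟩]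
  exact le_rfl

theorem bidegree_of_neg {A B : Submodule ℂ T} {p : ℤ} (hp : p < 0) (q : ℤ) :
    bidegree P V A B p q = ⊥ := if_neg fun h => absurd h.1 hp.not_ge

/-- A single odd generator squares to zero. This is what limits the Hodge filtration on `ℂ` to two
steps. -/
theorem bidegree_of_two_le {α : T} {B : Submodule ℂ T} {p : ℤ} (hp : 2 ≤ p) (q : ℤ) :
    bidegree P V (Submodule.span ℂ {α}) B p q = ⊥ := by
  unfold bidegree
  split_ifs with hpq
  · have h2 : ((Submodule.span ℂ {α}).map (ExteriorAlgebra.ι ℂ)) ^ 2 = ⊥ := by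
      rw [Submodule.map_span, Set.image_singleton, pow_two, Submodule.span_mul_span]
      simp
    obtain ⟨m, rfl⟩ : ∃ m : ℕ, p = ((2 + m : ℕ) : ℤ) := ⟨(p - 2).toNat, by omega⟩
    rw [Int.toNat_natCast, pow_add, h2, Submodule.bot_mul, Submodule.bot_mul,
      Submodule.map₂_bot_right]
  · rfl

theorem map_bidegree {E' : Type*} [NormedAddCommGroup E'] [NormedSpace ℝ E']
    {P' : Submodule ℝ E'} {T' : Type*} [AddCommGroup T'] [Module ℂ T']
    (f : smoothInv P' V →ₗ[ℂ] smoothInv P V) (hf : Function.Surjective f) (h : T' →ₗ[ℂ] T)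
    (A B : Submodule ℂ T') (p q : ℤ) :
    (bidegree P' V A B p q).map (TensorProduct.map f (ExteriorAlgebra.map h).toLinearMap) =
      bidegree P V (A.map h) (B.map h) p q := by
  unfold bidegree
  split_ifs with hpq
  · rw [← map_bigraded, Submodule.map_map₂]
    have e : (⊤ : Submodule ℂ (smoothInv P V)) = Submodule.map f ⊤ := by
      rw [Submodule.map_top, LinearMap.range_eq_top.2 hf]
    rw [e, Submodule.map₂_map_map]
    rfl
  · exact Submodule.map_bot _

end Bidegree

/-! ### The double complex of forms on `ℂ`. -/

section Hodge

variable (V : Type*) [NormedAddCommGroup V] [NormedSpace ℂ V]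

theorem span_dz_sup_span_dzbar :
    Submodule.span ℂ {dz} ⊔ Submodule.span ℂ {dzbar} = ⊤ := by
  refine top_le_iff.1 fun x _ => ?_
  have e : x = x.1 • dz + x.2 • dzbar := by ext <;> simp [dz, dzbar]
  rw [e]
  exact Submodule.add_mem_sup (Submodule.smul_mem _ _ (Submodule.mem_span_singleton_self _))
    (Submodule.smul_mem _ _ (Submodule.mem_span_singleton_self _))

theorem iSupIndep_hodge : iSupIndep fun pq : ℤ × ℤ => (hodge V).K pq.1 pq.2 := by
  refine iSupIndep_bidegree ⊥ V _ _
    (((2 : ℂ) • LinearMap.id).prodMap ((3 : ℂ) • LinearMap.id)) ?_ ?_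
  · intro a ha
    obtain ⟨c, rfl⟩ := Submodule.mem_span_singleton.1 ha
    ext <;> simp [dz]
  · intro a ha
    obtain ⟨c, rfl⟩ := Submodule.mem_span_singleton.1 ha
    ext <;> simp [dzbar]

theorem iSup_hodge : ⨆ pq : ℤ × ℤ, (hodge V).K pq.1 pq.2 = ⊤ :=
  iSup_bidegree_eq_top ⊥ V span_dz_sup_span_dzbar

theorem isInternal_bgHodge :
    DirectSum.IsInternal fun pq : ℤ × ℤ => (bgHodge V).K pq.1 pq.2 :=
  DirectSum.isInternal_submodule_of_iSupIndep_of_iSup_eq_top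
    (DoubleComplex.sumShift_iSupIndep (iSupIndep_hodge V) (iSupIndep_hodge _))
    (DoubleComplex.sumShift_iSup_eq_top (iSup_hodge V) (iSup_hodge _))

theorem bgHodge_K_eq_bot {p : ℤ} (hp : p < 0 ∨ 2 ≤ p) (q : ℤ) : (bgHodge V).K p q = ⊥ := by
  have h : ∀ (W : Type _) [NormedAddCommGroup W] [NormedSpace ℂ W] (q : ℤ),
      (hodge W).K p q = ⊥ := fun W _ _ q =>
    hp.elim (fun hp => bidegree_of_neg ⊥ W hp q) (fun hp => bidegree_of_two_le ⊥ W hp q)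
  change ((hodge V).K p q).prod ((hodge (V →L[ℂ] ℂ)).K p (q + 1)) = ⊥
  rw [h, h, Submodule.prod_bot]

theorem bgHodge_F_zero : (bgHodge V).F 0 = ⊤ := by
  rw [← top_le_iff, ← (isInternal_bgHodge V).submodule_iSup_eq_top]
  refine iSup_le fun pq => ?_
  rcases lt_or_ge pq.1 0 with h | h
  · rw [bgHodge_K_eq_bot V (Or.inl h)]
    exact bot_le
  · exact (bgHodge V).K_le_F h _

theorem bgHodge_F_two : (bgHodge V).F 2 = ⊥ := by
  rw [← le_bot_iff]
  refine iSup₂_le fun p hp => iSup_le fun q => ?_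
  rw [bgHodge_K_eq_bot V (Or.inr hp)]

end Hodge

/-! ### Pull-back along a linear map with kernel `P`. -/

section PullBack

variable {E E' : Type*} [NormedAddCommGroup E] [NormedSpace ℝ E] [NormedAddCommGroup E']
  [NormedSpace ℝ E'] (P : Submodule ℝ E) (V : Type*) [NormedAddCommGroup V] [NormedSpace ℂ V]
variable {T : Type*} [AddCommGroup T] [Module ℂ T] {T' : Type*} [AddCommGroup T'] [Module ℂ T']

/-- Pull-back of functions along a linear map that kills `P`. -/
def pullFun (w : E →L[ℝ] E') (hw : ∀ v ∈ P, w v = 0) :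
    smoothInv (⊥ : Submodule ℝ E') V →ₗ[ℂ] smoothInv P V where
  toFun f := ⟨fun x => f.1 (w x), f.2.1.comp w.contDiff, fun v hv x => by simp [hw v hv]⟩
  map_add' _ _ := rfl
  map_smul' _ _ := rfl

theorem pullForms_eq (w : E →L[ℝ] E') (hw : ∀ v ∈ P, w v = 0) (h : T' →ₗ[ℂ] T) :
    pullForms P V w hw h =
      TensorProduct.map (pullFun P V w hw) (ExteriorAlgebra.map h).toLinearMap := rfl

/-- For surjectivity take a linear section `s` of `w`. Then `f ∘ s` is smooth and pulls back to `f`,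
because `s (w x) - x` lies in the kernel `P`, along which `f` is invariant. -/
theorem pullFun_bijective [FiniteDimensional ℝ E'] (w : E →L[ℝ] E') (hw : ∀ v, v ∈ P ↔ w v = 0)
    (hsurj : Function.Surjective w) :
    Function.Bijective (pullFun P V w fun v hv => (hw v).1 hv) := by
  constructor
  · intro f g hfg
    refine Subtype.ext (funext fun y => ?_)
    obtain ⟨x, rfl⟩ := hsurj y
    exact congrFun (congrArg Subtype.val hfg) x
  · intro f
    obtain ⟨s, hs⟩ := w.toLinearMap.exists_rightInverse_of_surjective
      (LinearMap.range_eq_top.2 hsurj)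
    have hs' : ∀ y, w (s y) = y := fun y => LinearMap.congr_fun hs y
    refine ⟨⟨fun y => f.1 (s y), f.2.1.comp s.toContinuousLinearMap.contDiff, ?_⟩, ?_⟩
    · intro v hv x
      rw [(Submodule.mem_bot ℝ).1 hv, add_zero]
    · refine Subtype.ext (funext fun x => ?_)
      change f.1 (s (w x)) = f.1 x
      have h1 := f.2.2 (s (w x) - x) ((hw _).2 (by rw [map_sub, hs', sub_self])) x
      rwa [add_sub_cancel] at h1

theorem exteriorAlgebra_map_bijective (h : T' ≃ₗ[ℂ] T) :
    Function.Bijective (ExteriorAlgebra.map h.toLinearMap) :=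
  ⟨ExteriorAlgebra.map_injective_field (LinearMap.ker_eq_bot.2 h.injective),
    ExteriorAlgebra.map_surjective_iff.2 h.surjective⟩

theorem pullForms_bijective [FiniteDimensional ℝ E'] (w : E →L[ℝ] E')
    (hw : ∀ v, v ∈ P ↔ w v = 0) (hsurj : Function.Surjective w) (h : T' ≃ₗ[ℂ] T) :
    Function.Bijective (pullForms P V w (fun v hv => (hw v).1 hv) h.toLinearMap) :=
  TensorProduct.map_bijective (pullFun_bijective P V w hw hsurj)
    (exteriorAlgebra_map_bijective h)

end PullBack

/-! ### Spinors and null translations -/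

theorem gam_apply (ε s : Spinor) : Gam ε s =
    ![(s 0 * ε 0 - s 1 * ε 1) / 2, Complex.I * (s 0 * ε 0 + s 1 * ε 1) / 2,
      (s 0 * ε 1 + s 1 * ε 0) / 2, Complex.I * (s 1 * ε 0 - s 0 * ε 1) / 2] := by
  ext j
  fin_cases j <;>
  simp [Gam, Fintype.linearCombination_apply, nullVec, dZ, dZbar, leviCivita] <;> ring

theorem gam_single (ε : Spinor) (i : Fin 2) : Gam ε (Pi.single i 1) = nullVec ε i := by
  rw [Gam, Fintype.linearCombination_apply_single, one_smul]

theorem nullVec_add_smul (x y : ℂ) (a b : Spinor) (i : Fin 2) :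
    nullVec (x • a + y • b) i = x • nullVec a i + y • nullVec b i := by
  simp only [nullVec, Pi.add_apply, Pi.smul_apply, smul_eq_mul]
  module

/-- The coordinates of `Γ(ε,s)` are invertible linear combinations of the four products `s_i ε_j`;
in other words `Γ` is injective on the tensor product. -/
theorem gam_eq_gam {ε s ε' s' : Spinor} (h : Gam ε s = Gam ε' s') :
    s 0 * ε 0 = s' 0 * ε' 0 ∧ s 1 * ε 1 = s' 1 * ε' 1 ∧ s 0 * ε 1 = s' 0 * ε' 1 ∧
      s 1 * ε 0 = s' 1 * ε' 0 := by
  rw [gam_apply, gam_apply] at h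
  have h0 := congrFun h 0
  have h1 := congrFun h 1
  have h2 := congrFun h 2
  have h3 := congrFun h 3
  simp only [Matrix.cons_val] at h0 h1 h2 h3
  have hI := Complex.I_ne_zero
  have h1' : s 0 * ε 0 + s 1 * ε 1 = s' 0 * ε' 0 + s' 1 * ε' 1 := by
    refine mul_left_cancel₀ hI ?_; linear_combination 2 * h1
  have h3' : s 1 * ε 0 - s 0 * ε 1 = s' 1 * ε' 0 - s' 0 * ε' 1 := by
    refine mul_left_cancel₀ hI ?_; linear_combination 2 * h3
  refine ⟨?_, ?_, ?_, ?_⟩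
  · linear_combination h0 + h1' / 2
  · linear_combination -h0 + h1' / 2
  · linear_combination h2 - h3' / 2
  · linear_combination h2 + h3' / 2

theorem spinor_ne_zero {ε : Spinor} (h : ε ≠ 0) : ε 0 ≠ 0 ∨ ε 1 ≠ 0 := by
  by_contra! hc
  exact h (by ext i; fin_cases i <;> simp [hc])

theorem gam_eq_zero {ε s : Spinor} (h : Gam ε s = 0) (hε : ε ≠ 0) : s = 0 := by
  obtain ⟨h0, h1, h2, h3⟩ := gam_eq_gam (ε' := ε) (s' := 0) (h.trans (map_zero _).symm)
  simp only [Pi.zero_apply, zero_mul, mul_eq_zero] at h0 h1 h2 h3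
  have := spinor_ne_zero hε
  ext i
  fin_cases i <;> simp <;> tauto

theorem gam_injective {ε : Spinor} (hε : ε ≠ 0) : Function.Injective (Gam ε) :=
  (injective_iff_map_eq_zero _).2 fun _ h => gam_eq_zero h hε

theorem nilpotenceVariety_eq : nilpotenceVariety = {Q | Q.2 = 0} ∪ {Q | Q.1 = 0} := by
  ext ⟨ε, s⟩
  change Gam ε s + Gam ε s = 0 ↔ s = 0 ∨ ε = 0
  rw [← two_smul ℂ (Gam ε s), smul_eq_zero, or_iff_right two_ne_zero]
  constructor
  · intro h
    by_cases hε : ε = 0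
    · exact Or.inr hε
    · exact Or.inl (gam_eq_zero h hε)
  · rintro (rfl | rfl)
    · exact map_zero _
    · rw [gam_apply]; ext i; fin_cases i <;> simp

/-- `S₊` and `S₋` are closed and meet only at the origin, so a connected set avoiding the origin
stays in one of them. Conversely `S₊ \ 0` is connected, being the complement of a point in a real
vector space of dimension four. -/
theorem connectedComponentIn_nilpotenceVariety (Q : Spinor × Spinor) (hQ : Q ≠ 0)
    (hQ2 : Q.2 = 0) :
    connectedComponentIn (nilpotenceVariety \ {0}) Q = {Q' | Q' ≠ 0 ∧ Q'.2 = 0} := by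
  have hmem : Q ∈ nilpotenceVariety \ {0} := by
    rw [nilpotenceVariety_eq]; exact ⟨Or.inl hQ2, hQ⟩
  refine Set.Subset.antisymm ?_ ?_
  · intro Q' hQ'
    have hsub := connectedComponentIn_subset (nilpotenceVariety \ {0}) Q
    refine ⟨(hsub hQ').2, ?_⟩
    by_contra hne
    have hQ1 : Q'.1 = 0 := by
      have := (hsub hQ').1
      rw [nilpotenceVariety_eq] at this
      exact this.resolve_left hne
    obtain ⟨R, hR, hR1, hR2⟩ := isPreconnected_closed_iff.1
      (isPreconnected_connectedComponentIn (x := Q) (F := nilpotenceVariety \ {0}))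
      {Q | Q.2 = 0} {Q | Q.1 = 0} (isClosed_eq continuous_snd continuous_const)
      (isClosed_eq continuous_fst continuous_const)
      (by rw [← nilpotenceVariety_eq]; exact fun x hx => (hsub hx).1)
      ⟨Q, mem_connectedComponentIn hmem, hQ2⟩ ⟨Q', hQ', hQ1⟩
    exact (hsub hR).2 (Prod.ext hR2 hR1)
  · have hrank : 1 < Module.rank ℝ Spinor := by
      refine Module.lt_rank_of_lt_finrank ?_
      rw [finrank_real_of_complex, Module.finrank_fin_fun]
      norm_num
    have hpre : IsPreconnected ((fun ε : Spinor => ((ε, 0) : Spinor × Spinor)) '' {0}ᶜ) :=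
      (isPathConnected_compl_singleton_of_one_lt_rank hrank 0).isConnected.isPreconnected.image _
        (by fun_prop)
    have himg : (fun ε : Spinor => ((ε, 0) : Spinor × Spinor)) '' {0}ᶜ =
        {Q' | Q' ≠ 0 ∧ Q'.2 = 0} := by
      ext ⟨ε, s⟩
      simp only [Set.mem_image, Set.mem_compl_iff, Set.mem_singleton_iff, Prod.mk.injEq,
        Set.mem_ofPred_eq, ne_eq, Prod.mk_eq_zero]
      constructor
      · rintro ⟨ε, hε, rfl, rfl⟩
        exact ⟨fun h => hε h.1, rfl⟩
      · rintro ⟨h, rfl⟩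
        exact ⟨ε, fun h' => h ⟨h', rfl⟩, rfl, rfl⟩
    rw [← himg]
    refine hpre.subset_connectedComponentIn ?_ ?_
    · rw [himg]; exact ⟨hQ, hQ2⟩
    · rw [himg, nilpotenceVariety_eq]
      exact fun x hx => ⟨Or.inl hx.2, hx.1⟩

/-! ### Complex structures -/

/-- Left multiplication by the imaginary quaternion `α i + β j + γ k` on `ℝ⁴ = ℍ`. -/
def quaternionMatrix (α β γ : ℝ) : Matrix (Fin 4) (Fin 4) ℝ :=
  !![0, -α, -β, -γ; α, 0, -γ, β; β, γ, 0, -α; γ, -β, α, 0]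

/-- With `p` the imaginary part of the quaternion `v ū`, the determinant is the squared length of
the cross product `(α,β,γ) × p`. Its nonnegativity is the orientation condition. -/
theorem det_quaternionMatrix (α β γ : ℝ) (u v : Fin 4 → ℝ) :
    (Matrix.of ![u, (quaternionMatrix α β γ).mulVec u, v,
      (quaternionMatrix α β γ).mulVec v]).det =
    (β * (v 3 * u 0 - v 0 * u 3 - v 1 * u 2 + v 2 * u 1) -
        γ * (v 2 * u 0 - v 0 * u 2 - v 3 * u 1 + v 1 * u 3)) ^ 2 +
      (γ * (v 1 * u 0 - v 0 * u 1 - v 2 * u 3 + v 3 * u 2) -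
        α * (v 3 * u 0 - v 0 * u 3 - v 1 * u 2 + v 2 * u 1)) ^ 2 +
      (α * (v 2 * u 0 - v 0 * u 2 - v 3 * u 1 + v 1 * u 3) -
        β * (v 1 * u 0 - v 0 * u 1 - v 2 * u 3 + v 3 * u 2)) ^ 2 := by
  simp [Matrix.det_succ_row_zero, Fin.sum_univ_succ, quaternionMatrix, dotProduct,
    Fin.succAbove]
  ring

theorem quaternionMatrix_mem {α β γ : ℝ} (h : α ^ 2 + β ^ 2 + γ ^ 2 = 1) :
    quaternionMatrix α β γ ∈ ComplexStructures := by
  refine ⟨?_, ?_, fun u v => ?_⟩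
  · ext i j
    fin_cases i <;> fin_cases j <;>
      simp [quaternionMatrix, Matrix.mul_apply, Fin.sum_univ_succ] <;> linarith
  · ext i j
    fin_cases i <;> fin_cases j <;>
      simp [quaternionMatrix, Matrix.mul_apply, Fin.sum_univ_succ] <;> linarith
  · rw [det_quaternionMatrix]
    positivity

/-- `J` is antisymmetric, so it is encoded by the vector `(J₁₀, J₂₀, J₃₀)` of its first column and
the vector `(J₃₂, -J₃₁, J₂₁)` of its lower block. The equation `J² = -1` makes both unit vectors and
parallel, so they agree up to a sign `t`, and the orientation selects `t = 1`. -/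
theorem exists_eq_quaternionMatrix {J : Matrix (Fin 4) (Fin 4) ℝ} (hJ : J ∈ ComplexStructures) :
    ∃ α β γ : ℝ, α ^ 2 + β ^ 2 + γ ^ 2 = 1 ∧ J = quaternionMatrix α β γ := by
  obtain ⟨h1, h2, h3⟩ := hJ
  have hanti : J.transpose = -J := by
    have : J.transpose * J * J = J := by rw [h2, one_mul]
    rw [mul_assoc, h1, mul_neg, mul_one] at this
    rw [← this, neg_neg, this]
  have ha : ∀ i j, J j i = -J i j := fun i j => by
    simpa using congrFun (congrFun hanti i) j
  have hd : ∀ i, J i i = 0 := fun i => by linarith [ha i i]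
  have hsq : ∀ i j, ∑ k, J i k * J k j = (-1 : Matrix (Fin 4) (Fin 4) ℝ) i j := fun i j => by
    rw [← h1, Matrix.mul_apply]
  have e00 := hsq 0 0
  have e01 := hsq 0 1
  have e02 := hsq 0 2
  have e03 := hsq 0 3
  have e11 := hsq 1 1
  have e22 := hsq 2 2
  have e33 := hsq 3 3
  simp [Fin.sum_univ_four, hd] at e00 e01 e02 e03 e11 e22 e33
  rw [ha 1 0, ha 2 0, ha 3 0] at e00
  have hn : J 1 0 ^ 2 + J 2 0 ^ 2 + J 3 0 ^ 2 = 1 := by linarith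
  have d : ∀ k : Fin 4, 0 ≤ (Matrix.of ![Pi.single 0 1, J.mulVec (Pi.single 0 1), Pi.single k 1,
    J.mulVec (Pi.single k 1)]).det := fun k => h3 _ _
  have d1 := d 1
  have d2 := d 2
  have d3 := d 3
  simp [Matrix.det_succ_row_zero, Fin.sum_univ_succ, Fin.succAbove, hd] at d1 d2 d3
  simp only [ha 1 0, ha 2 0, ha 3 0, ha 2 1, ha 3 1, ha 3 2] at e01 e02 e03 e11 e22 e33 d2 d3
  -- This is the Pfaffian of `J`, the inner product of the two vectors. The three determinants `d1`,
  -- `d2`, `d3` add up to `2t`, whence `t ≥ 0` below.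
  obtain ⟨t, ht⟩ : ∃ t, t = J 1 0 * J 3 2 - J 2 0 * J 3 1 + J 3 0 * J 2 1 := ⟨_, rfl⟩
  have r1 : J 3 2 = t * J 1 0 := by
    rw [ht]; linear_combination -J 3 2 * hn - J 3 0 * e02 + J 2 0 * e03
  have r2 : J 3 1 = -(t * J 2 0) := by
    rw [ht]; linear_combination -J 3 1 * hn - J 3 0 * e01 + J 1 0 * e03
  have r3 : J 2 1 = t * J 3 0 := by
    rw [ht]; linear_combination -J 2 1 * hn - J 2 0 * e01 + J 1 0 * e02
  have ht0 : 0 ≤ t := by linarith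
  have ht2 : (t - 1) * (t + 1) = 0 := by
    have h4 : J 3 2 ^ 2 + J 3 1 ^ 2 + J 2 1 ^ 2 = 1 := by linarith
    rw [r1, r2, r3] at h4
    linear_combination h4 - t ^ 2 * hn
  have ht1 : t = 1 := by
    rcases mul_eq_zero.1 ht2 with h | h <;> linarith
  rw [ht1, one_mul] at r1 r2 r3
  refine ⟨J 1 0, J 2 0, J 3 0, hn, ?_⟩
  ext i j
  fin_cases i <;> fin_cases j <;>
    simp [quaternionMatrix, hd, ha 1 0, ha 2 0, ha 3 0, ha 2 1, ha 3 1, ha 3 2, r1, r2, r3]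

/-- The `i`-component of the orthogonal complex structure determined by a spinor. -/
def spinorI (ε : Spinor) : ℝ :=
  (Complex.normSq (ε 0) - Complex.normSq (ε 1)) / (Complex.normSq (ε 0) + Complex.normSq (ε 1))

/-- The `j`-component of the orthogonal complex structure determined by a spinor. -/
def spinorJ (ε : Spinor) : ℝ :=
  -2 * (ε 0 * star (ε 1)).im / (Complex.normSq (ε 0) + Complex.normSq (ε 1))

/-- The `k`-component of the orthogonal complex structure determined by a spinor. -/
def spinorK (ε : Spinor) : ℝ :=
  -2 * (ε 0 * star (ε 1)).re / (Complex.normSq (ε 0) + Complex.normSq (ε 1))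

/-- The orthogonal complex structure determined by a spinor. -/
def spinorMatrix (ε : Spinor) : Matrix (Fin 4) (Fin 4) ℝ :=
  quaternionMatrix (spinorI ε) (spinorJ ε) (spinorK ε)

theorem normSq_add_pos {ε : Spinor} (hε : ε ≠ 0) :
    0 < Complex.normSq (ε 0) + Complex.normSq (ε 1) := by
  rcases spinor_ne_zero hε with h | h
  · exact add_pos_of_pos_of_nonneg (Complex.normSq_pos.2 h) (Complex.normSq_nonneg _)
  · exact add_pos_of_nonneg_of_pos (Complex.normSq_nonneg _) (Complex.normSq_pos.2 h)

theorem spinorMatrix_mem {ε : Spinor} (hε : ε ≠ 0) : spinorMatrix ε ∈ ComplexStructures := by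
  refine quaternionMatrix_mem ?_
  have h := (normSq_add_pos hε).ne'
  rw [spinorI, spinorJ, spinorK, div_pow, div_pow, div_pow, ← add_div, ← add_div,
    div_eq_one_iff_eq (pow_ne_zero 2 h)]
  simp [Complex.normSq_apply]
  ring

theorem spinorMatrix_smul (ε : Spinor) {c : ℂ} (hc : c ≠ 0) :
    spinorMatrix (c • ε) = spinorMatrix ε := by
  have hc' : Complex.normSq c ≠ 0 := (Complex.normSq_pos.2 hc).ne'
  have h1 : c * ε 0 * star (c * ε 1) = (Complex.normSq c : ℂ) * (ε 0 * star (ε 1)) := by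
    rw [Complex.normSq_eq_conj_mul_self, star_mul]
    simp only [Complex.star_def]
    ring
  have h2 : spinorI (c • ε) = spinorI ε := by
    simp only [spinorI, Pi.smul_apply, smul_eq_mul, Complex.normSq_mul, ← mul_add, ← mul_sub]
    exact mul_div_mul_left _ _ hc'
  have h3 : spinorJ (c • ε) = spinorJ ε := by
    simp only [spinorJ, Pi.smul_apply, smul_eq_mul, Complex.normSq_mul, ← mul_add, h1,
      Complex.im_ofReal_mul, mul_left_comm (-2 : ℝ)]
    exact mul_div_mul_left _ _ hc'
  have h4 : spinorK (c • ε) = spinorK ε := by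
    simp only [spinorK, Pi.smul_apply, smul_eq_mul, Complex.normSq_mul, ← mul_add, h1,
      Complex.re_ofReal_mul, mul_left_comm (-2 : ℝ)]
    exact mul_div_mul_left _ _ hc'
  rw [spinorMatrix, h2, h3, h4, spinorMatrix]

theorem mem_T01_quaternionMatrix {α β γ : ℝ} {v : CVec} : v ∈ T01 (quaternionMatrix α β γ) ↔
    -α * v 1 - β * v 2 - γ * v 3 = -Complex.I * v 0 ∧
    α * v 0 - γ * v 2 + β * v 3 = -Complex.I * v 1 ∧
    β * v 0 + γ * v 1 - α * v 3 = -Complex.I * v 2 ∧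
    γ * v 0 - β * v 1 + α * v 2 = -Complex.I * v 3 := by
  rw [T01, LinearMap.mem_ker, funext_iff, Fin.forall_fin_succ, Fin.forall_fin_succ,
    Fin.forall_fin_succ, Fin.forall_fin_succ]
  simp [quaternionMatrix, Matrix.toLin'_apply, Matrix.mulVec, dotProduct, Fin.sum_univ_succ]
  refine and_congr ?_ (and_congr ?_ (and_congr ?_ ?_)) <;>
  constructor <;> intro h <;> linear_combination h

theorem T01_spinorMatrix {ε : Spinor} (hε : ε ≠ 0) :
    T01 (spinorMatrix ε) = nullTranslations ε := by
  have hN : (ε 0 * star (ε 0) + ε 1 * star (ε 1) : ℂ) ≠ 0 := by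
    have h := (normSq_add_pos hε).ne'
    simp only [Complex.star_def, Complex.mul_conj]
    exact_mod_cast h
  have hN' : ((Complex.normSq (ε 0) + Complex.normSq (ε 1) : ℝ) : ℂ) =
      ε 0 * star (ε 0) + ε 1 * star (ε 1) := by
    push_cast
    simp only [Complex.star_def, Complex.mul_conj]
  have hα : (spinorI ε : ℂ) * (ε 0 * star (ε 0) + ε 1 * star (ε 1)) =
      ε 0 * star (ε 0) - ε 1 * star (ε 1) := by
    rw [spinorI, Complex.ofReal_div, hN', div_mul_cancel₀ _ hN, Complex.ofReal_sub,
      ← Complex.mul_conj, ← Complex.mul_conj]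
    rfl
  have hβ : (spinorJ ε : ℂ) * (ε 0 * star (ε 0) + ε 1 * star (ε 1)) =
      Complex.I * (ε 0 * star (ε 1) - star (ε 0) * ε 1) := by
    rw [spinorJ, Complex.ofReal_div, hN', div_mul_cancel₀ _ hN]
    apply Complex.ext <;> simp
    ring
  have hγ : (spinorK ε : ℂ) * (ε 0 * star (ε 0) + ε 1 * star (ε 1)) =
      -(ε 0 * star (ε 1) + star (ε 0) * ε 1) := by
    rw [spinorK, Complex.ofReal_div, hN', div_mul_cancel₀ _ hN]
    apply Complex.ext <;> simp <;> ring
  ext v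
  rw [spinorMatrix, mem_T01_quaternionMatrix]
  have hI := Complex.I_mul_I
  clear hN' hε
  -- Conjugates and quaternion components now become independent variables tied only by `hα`, `hβ`,
  -- `hγ`, so that what remains is polynomial algebra.
  generalize star (ε 0) = a at *
  generalize star (ε 1) = b at *
  generalize (spinorI ε : ℂ) = α at *
  generalize (spinorJ ε : ℂ) = β at *
  generalize (spinorK ε : ℂ) = γ at *
  constructor
  · rintro ⟨h0, h1, h2, h3⟩
    -- If `v = Γ(ε,s)`, the coordinates of `v` determine the products `s_i ε_j`. Contracting these
    -- with the conjugate of `ε` gives `|ε|² s`, which is the spinor written here.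
    have key : Gam ε ![a * v 0 - Complex.I * a * v 1 + b * v 2 + Complex.I * b * v 3,
        -b * v 0 - Complex.I * b * v 1 + a * v 2 - Complex.I * a * v 3] = (ε 0 * a + ε 1 * b) • v := by
      rw [gam_apply]
      generalize Complex.I = I at *
      generalize ε 0 = x at *
      generalize ε 1 = y at *
      ext j
      fin_cases j <;> simp <;> (clear hN; grind)
    refine ⟨(ε 0 * a + ε 1 * b)⁻¹ • ![a * v 0 - Complex.I * a * v 1 + b * v 2 + Complex.I * b * v 3,
        -b * v 0 - Complex.I * b * v 1 + a * v 2 - Complex.I * a * v 3], ?_⟩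
    rw [map_smul, key, smul_smul, inv_mul_cancel₀ hN, one_smul]
  · rintro ⟨s, rfl⟩
    rw [gam_apply]
    simp only [Matrix.cons_val]
    generalize Complex.I = I at *
    generalize ε 0 = x at *
    generalize ε 1 = y at *
    refine ⟨?_, ?_, ?_, ?_⟩ <;> (refine mul_left_cancel₀ hN ?_; clear hN; grind)

/-- The map from nonzero spinors to orthogonal complex structures. -/
def spinorStructure (ε : {ε : Spinor // ε ≠ 0}) : ComplexStructures :=
  ⟨spinorMatrix ε.1, spinorMatrix_mem ε.2⟩

theorem continuous_spinorStructure : Continuous spinorStructure := by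
  have hc : ∀ i, Continuous fun ε : {ε : Spinor // ε ≠ 0} => ε.1 i := fun i =>
    (continuous_apply i).comp continuous_subtype_val
  have hn : Continuous fun ε : {ε : Spinor // ε ≠ 0} =>
      Complex.normSq (ε.1 0) + Complex.normSq (ε.1 1) :=
    (Complex.continuous_normSq.comp (hc 0)).add (Complex.continuous_normSq.comp (hc 1))
  have hm : Continuous fun ε : {ε : Spinor // ε ≠ 0} => ε.1 0 * star (ε.1 1) :=
    (hc 0).mul (continuous_star.comp (hc 1))
  have h0 : ∀ ε : {ε : Spinor // ε ≠ 0},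
      Complex.normSq (ε.1 0) + Complex.normSq (ε.1 1) ≠ 0 := fun ε => (normSq_add_pos ε.2).ne'
  have hI : Continuous fun ε : {ε : Spinor // ε ≠ 0} => spinorI ε.1 :=
    ((Complex.continuous_normSq.comp (hc 0)).sub (Complex.continuous_normSq.comp (hc 1))).div hn h0
  have hJ : Continuous fun ε : {ε : Spinor // ε ≠ 0} => spinorJ ε.1 :=
    (continuous_const.mul (Complex.continuous_im.comp hm)).div hn h0
  have hK : Continuous fun ε : {ε : Spinor // ε ≠ 0} => spinorK ε.1 :=
    (continuous_const.mul (Complex.continuous_re.comp hm)).div hn h0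
  refine Continuous.subtype_mk (continuous_matrix fun i j => ?_) _
  fin_cases i <;> fin_cases j <;> simp [spinorMatrix, quaternionMatrix] <;> fun_prop

/-- Inverse stereographic projection: `(α,β,γ)` comes from the spinor `(-γ - βi, 1 - α)`, whose
squared length on the unit sphere is `2(1 - α)`. The pole `α = 1` comes from `(1,0)`. -/
theorem spinorStructure_surjective : Function.Surjective spinorStructure := by
  rintro ⟨J, hJ⟩
  obtain ⟨α, β, γ, h, rfl⟩ := exists_eq_quaternionMatrix hJ
  by_cases hα : α = 1
  · subst hα
    have hβ : β = 0 := by nlinarith [sq_nonneg β, sq_nonneg γ]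
    have hγ : γ = 0 := by nlinarith [sq_nonneg β, sq_nonneg γ]
    subst hβ hγ
    refine ⟨⟨![1, 0], fun h => by simpa using congrFun h 0⟩, Subtype.ext ?_⟩
    simp [spinorStructure, spinorMatrix, spinorI, spinorJ, spinorK]
  · have hα' : 1 - α ≠ 0 := sub_ne_zero.2 (Ne.symm hα)
    have hc : ((1 - α : ℝ) : ℂ) ≠ 0 := by exact_mod_cast hα'
    have hn : Complex.normSq (-γ - β * Complex.I) + Complex.normSq ((1 - α : ℝ) : ℂ) =
        2 * (1 - α) := by
      simp [Complex.normSq_apply]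
      linarith
    refine ⟨⟨![-γ - β * Complex.I, ((1 - α : ℝ) : ℂ)], fun h => hc (congrFun h 1)⟩,
      Subtype.ext ?_⟩
    have h2 : 2 * (1 - α) ≠ 0 := mul_ne_zero two_ne_zero hα'
    have e1 : spinorI ![-γ - β * Complex.I, ((1 - α : ℝ) : ℂ)] = α := by
      simp only [spinorI, Matrix.cons_val_zero, Matrix.cons_val_one, hn]
      rw [div_eq_iff h2]
      simp [Complex.normSq_apply]
      linarith
    have e2 : spinorJ ![-γ - β * Complex.I, ((1 - α : ℝ) : ℂ)] = β := by
      simp only [spinorJ, Matrix.cons_val_zero, Matrix.cons_val_one, hn]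
      rw [div_eq_iff h2]
      simp
      ring
    have e3 : spinorK ![-γ - β * Complex.I, ((1 - α : ℝ) : ℂ)] = γ := by
      simp only [spinorK, Matrix.cons_val_zero, Matrix.cons_val_one, hn]
      rw [div_eq_iff h2]
      simp
      ring
    change spinorMatrix _ = _
    rw [spinorMatrix, e1, e2, e3]

/-- By invariance under scaling, the restriction to the compact unit sphere of `S₊` is still onto. A
continuous surjection from a compact space to a Hausdorff space is a quotient map, and this property
passes to the map on all nonzero spinors. -/
theorem isQuotientMap_spinorStructure : Topology.IsQuotientMap spinorStructure := by
  let S := Metric.sphere (0 : Spinor) 1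
  have hS : ∀ ε : S, ε.1 ≠ 0 := fun ε h => by
    have := mem_sphere_zero_iff_norm.1 ε.2
    rw [h, norm_zero] at this
    exact zero_ne_one this
  let i : S → {ε : Spinor // ε ≠ 0} := fun ε => ⟨ε.1, hS ε⟩
  have hi : Continuous i := continuous_subtype_val.subtype_mk _
  have : CompactSpace S := isCompact_iff_compactSpace.1 (isCompact_sphere _ _)
  have hcont : Continuous (spinorStructure ∘ i) := continuous_spinorStructure.comp hi
  have hsurj : Function.Surjective (spinorStructure ∘ i) := by
    intro J
    obtain ⟨ε, rfl⟩ := spinorStructure_surjective J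
    have hn : ‖ε.1‖ ≠ 0 := norm_ne_zero_iff.2 ε.2
    have hc : ((‖ε.1‖ : ℂ))⁻¹ ≠ 0 := inv_ne_zero (by exact_mod_cast hn)
    refine ⟨⟨((‖ε.1‖ : ℂ))⁻¹ • ε.1, ?_⟩, Subtype.ext (spinorMatrix_smul ε.1 hc)⟩
    rw [mem_sphere_zero_iff_norm, norm_smul]
    simp [hn]
  exact .of_comp hi continuous_spinorStructure
    (hcont.isClosedMap.isQuotientMap hcont hsurj)

/-- The complex structure determines `Γ(ε,S₋)`. If this contains `Γ(ε',(1,0)) = Γ(ε,s)`, comparing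
products of coordinates gives `ε' = s₀ ε`. -/
theorem spinorStructure_eq_iff (ε ε' : {ε : Spinor // ε ≠ 0}) :
    spinorStructure ε = spinorStructure ε' ↔ ∃ c : ℂ, ε'.1 = c • ε.1 := by
  constructor
  · intro h
    have hT : nullTranslations ε'.1 = nullTranslations ε.1 := by
      rw [← T01_spinorMatrix ε.2, ← T01_spinorMatrix ε'.2]
      exact congrArg T01 (congrArg Subtype.val h).symm
    have hm : Gam ε'.1 (Pi.single 0 1) ∈ nullTranslations ε.1 := by
      rw [← hT]
      exact LinearMap.mem_range_self _ _
    obtain ⟨s, hs⟩ := hm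
    obtain ⟨h0, h1, h2, h3⟩ := gam_eq_gam hs
    refine ⟨s 0, ?_⟩
    ext j
    fin_cases j
    · simpa using h0.symm
    · simpa using h2.symm
  · rintro ⟨c, hc⟩
    refine Subtype.ext ?_
    have hc0 : c ≠ 0 := by
      rintro rfl
      exact ε'.2 (by rw [hc, zero_smul])
    change spinorMatrix ε.1 = spinorMatrix ε'.1
    rw [hc, spinorMatrix_smul _ hc0]

/-! ### Odd substitutions -/

section Substitution

variable {E : Type*} [NormedAddCommGroup E] [NormedSpace ℝ E] {P : Submodule ℝ E}
variable {V : Type*} [NormedAddCommGroup V] [NormedSpace ℂ V]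
variable {T : Type*} [AddCommGroup T] [Module ℂ T] {T' : Type*} [AddCommGroup T'] [Module ℂ T']

theorem dbar_tmul (P : Submodule ℝ R4) (ε : Spinor) (f : smoothInv P V)
    (l : ExteriorAlgebra ℂ Spinor) :
    dbar P V ε (f ⊗ₜ l) = ∑ i : Fin 2,
      cDeriv P V (nullVec ε i) f ⊗ₜ (ExteriorAlgebra.ι ℂ (Pi.single i 1) * l) := by
  simp [dbar, wedgeOp]

theorem mapOdd_dbar (J : Matrix (Fin 4) (Fin 4) ℝ) (ε : Spinor)
    (h : Spinor →ₗ[ℂ] Module.Dual ℂ (T01 J))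
    (hh : ∀ j, (LinearMap.proj j : CVec →ₗ[ℂ] ℂ) ∘ₗ (T01 J).subtype =
      ∑ i, nullVec ε i j • h (Pi.single i 1)) (η : Fields ⊥ V) :
    mapOdd ⊥ V h (dbar ⊥ V ε η) = dolbeault V J (mapOdd ⊥ V h η) := by
  suffices H : mapOdd ⊥ V h ∘ₗ dbar ⊥ V ε = dolbeault V J ∘ₗ mapOdd ⊥ V h from
    LinearMap.congr_fun H η
  refine TensorProduct.ext' fun f l => ?_
  simp only [LinearMap.comp_apply, dbar_tmul, map_sum, mapOdd, dolbeault, TensorProduct.map_tmul,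
    LinearMap.id_apply, AlgHom.toLinearMap_apply, map_mul, ExteriorAlgebra.map_apply_ι,
    LinearMap.sum_apply, wedgeOp, hh, LinearMap.mulLeft_apply, map_smul, cDeriv,
    LinearMap.smul_apply, Finset.sum_mul, TensorProduct.tmul_sum, TensorProduct.sum_tmul]
  rw [Finset.sum_comm]
  refine Finset.sum_congr rfl fun j _ => Finset.sum_congr rfl fun i _ => ?_
  rw [smul_mul_assoc, TensorProduct.smul_tmul]

/-- `s ↦ Γ(ε,s)` identifies `S₋` with `T^{0,1}`. The substitution sends `dz̄_i` to the dual basis of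
the vectors `nullVec ε i`, and the claim expands `dx_j` in that basis. -/
theorem exists_odd_substitution {ε : Spinor} (hε : ε ≠ 0) {J : Matrix (Fin 4) (Fin 4) ℝ}
    (hJ : T01 J = nullTranslations ε) :
    ∃ h : Spinor ≃ₗ[ℂ] Module.Dual ℂ (T01 J), ∀ j,
      (LinearMap.proj j : CVec →ₗ[ℂ] ℂ) ∘ₗ (T01 J).subtype =
        ∑ i, nullVec ε i j • h.toLinearMap (Pi.single i 1) := by
  let e : Spinor ≃ₗ[ℂ] T01 J := (LinearEquiv.ofInjective _ (gam_injective hε)).trans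
    (LinearEquiv.ofEq _ _ hJ.symm)
  have he : ∀ t, (e t : CVec) = Gam ε t := fun t => rfl
  refine ⟨(dotProductEquiv ℂ (Fin 2)).trans e.symm.dualMap, fun j => ?_⟩
  refine LinearMap.ext fun v => ?_
  obtain ⟨t, rfl⟩ := e.surjective v
  simp [he, Gam, Fintype.linearCombination_apply, mul_comm]

end Substitution

/-! ### The complex bilinear form and real planes -/

/-- The complex bilinear extension of the Euclidean inner product. -/
def pairing (n : CVec) : CVec →ₗ[ℂ] ℂ := Fintype.linearCombination ℂ n

theorem pairing_apply (n v : CVec) : pairing n v = ∑ j, v j * n j := by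
  simp [pairing, Fintype.linearCombination_apply]

theorem pairing_comm (n v : CVec) : pairing n v = pairing v n := by
  simp only [pairing_apply, mul_comm]

theorem pairing_star (n v : CVec) : pairing (star n) (star v) = star (pairing n v) := by
  simp [pairing_apply]

/-- The determinant of two spinors. -/
def wedge (a b : Spinor) : ℂ := a 0 * b 1 - a 1 * b 0

theorem wedge_swap (a b : Spinor) : wedge a b = -wedge b a := by
  simp only [wedge]; ring

/-- This turns every incidence between null translations and the plane into the vanishing of spinor
determinants. -/
theorem pairing_gam (a s ε t : Spinor) :
    pairing (Gam a s) (Gam ε t) = -(1 / 2) * (wedge a ε * wedge s t) := by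
  rw [pairing_apply, gam_apply, gam_apply, Fin.sum_univ_four]
  simp only [Matrix.cons_val, wedge]
  have hI := Complex.I_mul_I
  generalize Complex.I = I at *
  generalize ε 0 = x at *
  generalize ε 1 = y at *
  generalize a 0 = x' at *
  generalize a 1 = y' at *
  grind

theorem mem_span_singleton_iff_wedge {a : Spinor} (ha : a ≠ 0) (ε : Spinor) :
    ε ∈ Submodule.span ℂ {a} ↔ wedge a ε = 0 := by
  rw [Submodule.mem_span_singleton]
  constructor
  · rintro ⟨c, rfl⟩
    simp only [wedge, Pi.smul_apply, smul_eq_mul]; ring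
  · intro h
    rw [wedge, sub_eq_zero] at h
    rcases spinor_ne_zero ha with h0 | h1
    · refine ⟨ε 0 / a 0, ?_⟩
      ext i
      fin_cases i
      · simp [h0]
      · simp only [Fin.mk_one, Pi.smul_apply, smul_eq_mul]
        field_simp
        linear_combination -h
    · refine ⟨ε 1 / a 1, ?_⟩
      ext i
      fin_cases i
      · simp only [Fin.zero_eta, Pi.smul_apply, smul_eq_mul]
        field_simp
        linear_combination h
      · simp [h1]

theorem linearIndependent_iff_wedge {a b : Spinor} :
    LinearIndependent ℂ ![a, b] ↔ wedge a b ≠ 0 := by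
  have h := Matrix.linearIndependent_rows_iff_isUnit (A := Matrix.of ![a, b])
  rw [Matrix.isUnit_iff_isUnit_det, isUnit_iff_ne_zero, Matrix.det_fin_two] at h
  exact h

/-- A vector `n` prescribes the matrix of products `s_i a_j`, whose determinant is `-(n,n)`. Nullity
makes the matrix of rank at most one, hence an outer product; the cases only choose a nonzero entry
to divide by. -/
theorem exists_gam_eq {n : CVec} (hn : pairing n n = 0) : ∃ a s : Spinor, Gam a s = n := by
  rw [pairing_apply, Fin.sum_univ_four] at hn
  have hI := Complex.I_mul_I
  have key : ∀ a s : Spinor, s 0 * a 0 = n 0 - Complex.I * n 1 →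
      s 1 * a 1 = -n 0 - Complex.I * n 1 → s 0 * a 1 = n 2 + Complex.I * n 3 →
      s 1 * a 0 = n 2 - Complex.I * n 3 → Gam a s = n := by
    intro a s h0 h1 h2 h3
    rw [gam_apply, h0, h1, h2, h3]
    ext j
    fin_cases j
    · simp
    · simp only [Fin.mk_one, Matrix.cons_val]; linear_combination (-n 1) * hI
    · simp
    · simp only [Fin.reduceFinMk, Matrix.cons_val]; linear_combination (-n 3) * hI
  have hdet : (n 0 - Complex.I * n 1) * (-n 0 - Complex.I * n 1) =
      (n 2 + Complex.I * n 3) * (n 2 - Complex.I * n 3) := by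
    linear_combination -hn + (n 1 * n 1 + n 3 * n 3) * hI
  by_cases h0 : n 0 - Complex.I * n 1 = 0
  · by_cases h1 : n 2 + Complex.I * n 3 = 0
    · exact ⟨![n 2 - Complex.I * n 3, -n 0 - Complex.I * n 1], ![0, 1],
        key _ _ (by simp [h0]) (by simp) (by simp [h1]) (by simp)⟩
    · refine ⟨![n 0 - Complex.I * n 1, n 2 + Complex.I * n 3],
        ![1, (-n 0 - Complex.I * n 1) / (n 2 + Complex.I * n 3)],
        key _ _ (by simp) (by simp [h1]) (by simp) ?_⟩
      rw [h0, zero_mul] at hdet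
      simp [h0, (mul_eq_zero.1 hdet.symm).resolve_left h1]
  · refine ⟨![n 0 - Complex.I * n 1, n 2 + Complex.I * n 3],
      ![1, (n 2 - Complex.I * n 3) / (n 0 - Complex.I * n 1)],
      key _ _ (by simp) ?_ (by simp) (by simp [h0])⟩
    simp only [Matrix.cons_val_one, Matrix.cons_val_zero]
    rw [div_mul_eq_mul_div, div_eq_iff h0]
    linear_combination -hdet

/-- A real vector, as a complexified translation. -/
def realVec : R4 →ₗ[ℝ] CVec where
  toFun v j := (v j : ℂ)
  map_add' v w := by ext j; simp
  map_smul' c v := by ext j; simp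

theorem star_realVec (v : R4) : star (realVec v) = realVec v := by
  ext j; simp [realVec]

/-- The covector `n` is null, and its real and imaginary parts cut out the plane `P`. -/
structure IsNullConormal (P : Submodule ℝ R4) (n : CVec) : Prop where
  null : pairing n n = 0
  pairing_star_ne : pairing n (star n) ≠ 0
  mem_iff : ∀ v : R4, v ∈ P ↔ pairing n (realVec v) = 0

theorem IsNullConormal.star {P : Submodule ℝ R4} {n : CVec} (h : IsNullConormal P n) :
    IsNullConormal P (star n) where
  null := by rw [pairing_star, h.null, star_zero]
  pairing_star_ne := by
    rw [pairing_star, star_ne_zero]; exact h.pairing_star_ne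
  mem_iff v := by
    rw [h.mem_iff, ← star_realVec, pairing_star, star_eq_zero, star_realVec]

theorem exists_isNullConormal {P : Submodule ℝ R4} (hP : Module.finrank ℝ P = 2) :
    ∃ n, IsNullConormal P n := by
  have hP' : Module.finrank ℝ Pᗮ = 2 := by
    have := P.finrank_add_finrank_orthogonal
    rw [hP, finrank_euclideanSpace_fin] at this
    omega
  let u := (stdOrthonormalBasis ℝ Pᗮ).reindex (finCongr hP')
  have huu : ∀ i j, ∑ k, (u i : R4) k * (u j : R4) k = if i = j then 1 else 0 := by
    intro i j
    rw [← orthonormal_iff_ite.1 u.orthonormal i j]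
    simp [PiLp.inner_apply, mul_comm]
  have hC : ∀ i j, ∑ k, ((u i : R4) k : ℂ) * ((u j : R4) k : ℂ) = if i = j then 1 else 0 := by
    intro i j
    have := congrArg (fun r : ℝ => (r : ℂ)) (huu i j)
    push_cast at this
    rw [this]
    split_ifs <;> simp
  have c00 := hC 0 0
  have c01 := hC 0 1
  have c11 := hC 1 1
  simp only [Fin.sum_univ_four, if_true, zero_ne_one, if_false] at c00 c01 c11
  -- Orthonormality gives `(n,n) = 1 - 1 = 0` and `(n,n̄) = 2`.
  refine ⟨fun k => ((u 0 : R4) k : ℂ) + Complex.I * ((u 1 : R4) k : ℂ), ?_, ?_, fun v => ?_⟩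
  · rw [pairing_apply, Fin.sum_univ_four]
    linear_combination c00 + Complex.I * Complex.I * c11 + 2 * Complex.I * c01 + Complex.I_mul_I
  · have e : pairing (fun k => ((u 0 : R4) k : ℂ) + Complex.I * ((u 1 : R4) k : ℂ))
        (Star.star fun k => ((u 0 : R4) k : ℂ) + Complex.I * ((u 1 : R4) k : ℂ)) = 2 := by
      rw [pairing_apply, Fin.sum_univ_four]
      simp only [Pi.star_apply, star_add, star_mul', Complex.star_def, Complex.conj_ofReal,
        Complex.conj_I]
      linear_combination c00 - Complex.I * Complex.I * c11 - Complex.I_mul_I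
    rw [e]
    exact two_ne_zero
  · have e : pairing (fun k => ((u 0 : R4) k : ℂ) + Complex.I * ((u 1 : R4) k : ℂ)) (realVec v) =
        (inner ℝ (u 0 : R4) v : ℝ) + (inner ℝ (u 1 : R4) v : ℝ) * Complex.I := by
      simp only [pairing_apply, PiLp.inner_apply, Fin.sum_univ_four, realVec, LinearMap.coe_mk,
        AddHom.coe_mk, RCLike.inner_apply, conj_trivial]
      push_cast
      ring
    rw [e, Complex.ext_iff]
    simp only [Complex.add_re, Complex.ofReal_re, Complex.re_ofReal_mul, Complex.I_re, mul_zero,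
      add_zero, Complex.zero_re, Complex.add_im, Complex.ofReal_im, Complex.im_ofReal_mul,
      Complex.I_im, mul_one, zero_add, Complex.zero_im]
    constructor
    · exact fun hv => ⟨Submodule.inner_left_of_mem_orthogonal hv (u 0).2,
        Submodule.inner_left_of_mem_orthogonal hv (u 1).2⟩
    · rintro ⟨h0, h1⟩
      rw [← P.orthogonal_orthogonal, Submodule.mem_orthogonal]
      intro x hx
      have hs := congrArg Subtype.val (u.sum_repr ⟨x, hx⟩)
      rw [← show _ = x from hs, Fin.sum_univ_two]
      simp [inner_add_left, inner_smul_left, h0, h1]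

/-- The common kernel of `n` and `n̄` is stable under conjugation, so it contains the real and
imaginary parts of its elements, and these lie in `P`. -/
theorem IsNullConormal.complexify_eq {P : Submodule ℝ R4} {n : CVec} (h : IsNullConormal P n) :
    complexify P = LinearMap.ker ((pairing n).prod (pairing (Star.star n))) := by
  refine le_antisymm (Submodule.span_le.2 ?_) ?_
  · rintro _ ⟨p, hp, rfl⟩
    exact Prod.ext ((h.mem_iff p).1 hp) ((h.star.mem_iff p).1 hp)
  · intro v hv
    have h1 : pairing n v = 0 := congrArg Prod.fst hv
    have h2 : pairing (Star.star n) v = 0 := congrArg Prod.snd hv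
    have h3 : pairing n (Star.star v) = 0 := by
      rw [← star_star n, pairing_star, h2, star_zero]
    let x : R4 := WithLp.toLp 2 fun j => (v j).re
    let y : R4 := WithLp.toLp 2 fun j => (v j).im
    have hx : realVec x = (2⁻¹ : ℂ) • (v + Star.star v) := by
      ext j
      change ((v j).re : ℂ) = 2⁻¹ * (v j + (starRingEnd ℂ) (v j))
      rw [Complex.add_conj]; push_cast; ring
    have hy : Complex.I • realVec y = (2⁻¹ : ℂ) • (v - Star.star v) := by
      ext j
      change Complex.I * ((v j).im : ℂ) = 2⁻¹ * (v j - (starRingEnd ℂ) (v j))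
      rw [Complex.sub_conj]; push_cast; ring
    have hxP : x ∈ P := (h.mem_iff x).2 (by rw [hx, map_smul, map_add, h1, h3]; simp)
    have hyP : y ∈ P := by
      refine (h.mem_iff y).2 (mul_left_cancel₀ Complex.I_ne_zero ?_)
      rw [← smul_eq_mul, ← map_smul, hy, map_smul, map_sub, h1, h3]; simp
    have hv' : v = realVec x + Complex.I • realVec y := by rw [hx, hy]; module
    rw [hv']
    exact Submodule.add_mem _ (Submodule.subset_span ⟨x, hxP, rfl⟩)
      (Submodule.smul_mem _ _ (Submodule.subset_span ⟨y, hyP, rfl⟩))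

theorem IsNullConormal.pairing_prod_surjective {P : Submodule ℝ R4} {n : CVec}
    (h : IsNullConormal P n) :
    Function.Surjective ((pairing n).prod (pairing (Star.star n))) := by
  rintro ⟨x, y⟩
  have hc := h.pairing_star_ne
  refine ⟨(x / pairing n (Star.star n)) • Star.star n + (y / pairing n (Star.star n)) • n, ?_⟩
  have h2 := h.star.null
  refine Prod.ext ?_ ?_
  · simp [h.null, hc]
  · simp [h2, pairing_comm (Star.star n) n, hc]

theorem IsNullConormal.finrank_complexify {P : Submodule ℝ R4} {n : CVec}
    (h : IsNullConormal P n) : Module.finrank ℂ (complexify P) = 2 := by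
  have h1 := LinearMap.finrank_range_add_finrank_ker
    ((pairing n).prod (pairing (Star.star n)))
  rw [LinearMap.range_eq_top.2 h.pairing_prod_surjective, finrank_top, ← h.complexify_eq] at h1
  simp at h1
  omega

theorem finrank_nullTranslations {ε : Spinor} (hε : ε ≠ 0) :
    Module.finrank ℂ (nullTranslations ε) = 2 := by
  rw [nullTranslations, LinearMap.finrank_range_of_inj (gam_injective hε)]
  simp

/-! ### Holomorphic and B-model points for a plane. -/

section Twist

variable {P : Submodule ℝ R4} {n : CVec} {a b s t : Spinor}

theorem IsNullConormal.wedge_ne_zero (h : IsNullConormal P n) (ha : Gam a s = n)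
    (hb : Gam b t = Star.star n) : wedge a b ≠ 0 ∧ wedge s t ≠ 0 := by
  have h1 := h.pairing_star_ne
  rw [← hb, ← ha, pairing_gam] at h1
  exact mul_ne_zero_iff.1 (right_ne_zero_of_mul h1)

theorem left_ne_zero_of_wedge (h : wedge a b ≠ 0) : a ≠ 0 := by
  rintro rfl
  simp [wedge] at h

theorem right_ne_zero_of_wedge (h : wedge a b ≠ 0) : b ≠ 0 := by
  rintro rfl
  simp [wedge] at h

theorem eq_zero_of_wedge {x : Spinor} (hst : wedge s t ≠ 0) (hs : wedge s x = 0)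
    (ht : wedge t x = 0) : x = 0 := by
  simp only [wedge] at hst hs ht
  ext i
  refine (mul_eq_zero.1 ?_).resolve_left hst
  fin_cases i
  · change (s 0 * t 1 - s 1 * t 0) * x 0 = 0
    linear_combination t 0 * hs - s 0 * ht
  · change (s 0 * t 1 - s 1 * t 0) * x 1 = 0
    linear_combination t 1 * hs - s 1 * ht

theorem gam_mem_complexify_iff (h : IsNullConormal P n) (ha : Gam a s = n)
    (hb : Gam b t = Star.star n) (ε x : Spinor) :
    Gam ε x ∈ complexify P ↔ wedge a ε * wedge s x = 0 ∧ wedge b ε * wedge t x = 0 := by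
  have e : Gam ε x ∈ complexify P ↔ pairing n (Gam ε x) = 0 ∧
      pairing (Star.star n) (Gam ε x) = 0 := by
    rw [h.complexify_eq, LinearMap.mem_ker]
    exact Prod.mk_eq_zero
  have hc : (-(1 / 2) : ℂ) ≠ 0 := by norm_num
  rw [e, ← hb, ← ha, pairing_gam, pairing_gam, mul_eq_zero (a := -(1 / 2)), or_iff_right hc,
    mul_eq_zero (a := -(1 / 2)), or_iff_right hc]

/-- If `Γ(ε,x)` lies in `P_ℂ`, then `x` is proportional to both of the independent spinors `s` and
`t`, so `x = 0`. The two planes are therefore complementary in `ℂ⁴`. -/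
theorem isBTwist_of_wedge_ne_zero (h : IsNullConormal P n) (ha : Gam a s = n)
    (hb : Gam b t = Star.star n) {ε : Spinor} (h1 : wedge a ε ≠ 0) (h2 : wedge b ε ≠ 0) :
    IsBTwist P ε := by
  have h3 := Submodule.finrank_sup_add_finrank_inf_eq (nullTranslations ε) (complexify P)
  have h4 : nullTranslations ε ⊓ complexify P = ⊥ := by
    rw [eq_bot_iff]
    rintro _ ⟨⟨x, rfl⟩, hx⟩
    obtain ⟨h5, h6⟩ := (gam_mem_complexify_iff h ha hb ε x).1 hx
    rw [eq_zero_of_wedge (h.wedge_ne_zero ha hb).2 ((mul_eq_zero.1 h5).resolve_left h1)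
      ((mul_eq_zero.1 h6).resolve_left h2), map_zero]
    exact zero_mem _
  rw [h4, finrank_bot, finrank_nullTranslations (right_ne_zero_of_wedge h1),
    h.finrank_complexify] at h3
  exact h3

/-- Now the first incidence equation is vacuous and the second forces `x` to be a multiple of `t`.
The planes meet in a line, and `2 + 2 - 1 = 3`. -/
theorem isHolomorphicTwist_of_wedge_eq_zero (h : IsNullConormal P n) (ha : Gam a s = n)
    (hb : Gam b t = Star.star n) {ε : Spinor} (hε : ε ≠ 0) (h1 : wedge a ε = 0) :
    IsHolomorphicTwist P ε := by
  obtain ⟨hab, hst⟩ := h.wedge_ne_zero ha hb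
  have ht := right_ne_zero_of_wedge hst
  have h2 : wedge b ε ≠ 0 := fun h2 => hε (eq_zero_of_wedge hab h1 h2)
  have h3 := Submodule.finrank_sup_add_finrank_inf_eq (nullTranslations ε) (complexify P)
  have h4 : nullTranslations ε ⊓ complexify P = Submodule.span ℂ {Gam ε t} := by
    refine le_antisymm ?_ ?_
    · rintro _ ⟨⟨x, rfl⟩, hx⟩
      obtain ⟨-, h6⟩ := (gam_mem_complexify_iff h ha hb ε x).1 hx
      obtain ⟨c, rfl⟩ := Submodule.mem_span_singleton.1
        ((mem_span_singleton_iff_wedge ht x).2 ((mul_eq_zero.1 h6).resolve_left h2))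
      rw [map_smul]
      exact Submodule.smul_mem _ _ (Submodule.mem_span_singleton_self _)
    · rw [Submodule.span_singleton_le_iff_mem]
      refine ⟨LinearMap.mem_range_self _ _, (gam_mem_complexify_iff h ha hb ε t).2 ⟨?_, ?_⟩⟩
      · rw [h1, zero_mul]
      · simp only [wedge]; ring
  rw [h4, finrank_span_singleton fun h5 => ht (gam_eq_zero h5 hε), finrank_nullTranslations hε,
    h.finrank_complexify] at h3
  exact Nat.succ_injective h3

theorem IsNullConormal.isHolomorphicTwist_iff (h : IsNullConormal P n) (ha : Gam a s = n)
    (hb : Gam b t = Star.star n) (ε : Spinor) :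
    IsHolomorphicTwist P ε ↔ ε ≠ 0 ∧ (wedge a ε = 0 ∨ wedge b ε = 0) := by
  constructor
  · intro hε
    refine ⟨?_, ?_⟩
    · rintro rfl
      have h1 : nullTranslations 0 = ⊥ := by
        rw [nullTranslations, LinearMap.range_eq_bot]
        refine LinearMap.ext fun x => ?_
        rw [gam_apply]
        ext j
        fin_cases j <;> simp
      rw [IsHolomorphicTwist, h1, bot_sup_eq, h.finrank_complexify] at hε
      omega
    · by_contra! hc
      have h1 := isBTwist_of_wedge_ne_zero h ha hb hc.1 hc.2
      rw [IsHolomorphicTwist] at hε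
      rw [IsBTwist, hε] at h1
      omega
  · rintro ⟨h0, h1 | h1⟩
    · exact isHolomorphicTwist_of_wedge_eq_zero h ha hb h0 h1
    · exact isHolomorphicTwist_of_wedge_eq_zero h.star hb (by rw [ha, star_star]) h0 h1

theorem IsNullConormal.isBTwist_iff (h : IsNullConormal P n) (ha : Gam a s = n)
    (hb : Gam b t = Star.star n) {ε : Spinor} (hε : ε ≠ 0) :
    IsBTwist P ε ↔ ¬ IsHolomorphicTwist P ε := by
  constructor
  · intro h1 h2
    rw [IsHolomorphicTwist] at h2
    rw [IsBTwist, h2] at h1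
    omega
  · rw [h.isHolomorphicTwist_iff ha hb]
    intro h1
    push Not at h1
    exact isBTwist_of_wedge_ne_zero h ha hb (h1 hε).1 (h1 hε).2

end Twist

/-- The two points of the holomorphic twist in a basis correspond to the null conormal lines. -/
theorem exists_isNullConormal_of_isHolomorphicTwist {P : Submodule ℝ R4}
    (hP : Module.finrank ℝ P = 2) {a b : Spinor} (hab : wedge a b ≠ 0)
    (ha : IsHolomorphicTwist P a) (hb : IsHolomorphicTwist P b) :
    ∃ n s t, IsNullConormal P n ∧ Gam a s = n ∧ Gam b t = star n := by
  obtain ⟨n, hn⟩ := exists_isNullConormal hP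
  obtain ⟨a', s, ha'⟩ := exists_gam_eq hn.null
  obtain ⟨b', t, hb'⟩ := exists_gam_eq hn.star.null
  obtain ⟨hab', -⟩ := hn.wedge_ne_zero ha' hb'
  -- `Γ(kc,x) = Γ(c,kx)`: the scalar is absorbed into the `S₋` factor.
  have hrescale : ∀ {c c' x : Spinor} {m : CVec}, c ≠ 0 → wedge c' c = 0 → Gam c' x = m →
      ∃ y, Gam c y = m := by
    intro c c' x m hc h hx
    have h' : wedge c c' = 0 := by rw [wedge_swap, h, neg_zero]
    obtain ⟨k, rfl⟩ := Submodule.mem_span_singleton.1 ((mem_span_singleton_iff_wedge hc c').2 h')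
    refine ⟨k • x, ?_⟩
    rw [← hx, gam_apply, gam_apply]
    simp only [Pi.smul_apply, smul_eq_mul, mul_assoc, mul_left_comm, mul_comm]
  obtain ⟨ha0, ha1⟩ := (hn.isHolomorphicTwist_iff ha' hb' a).1 ha
  obtain ⟨hb0, hb1⟩ := (hn.isHolomorphicTwist_iff ha' hb' b).1 hb
  have hexcl : ∀ {c : Spinor}, c ≠ 0 → wedge c a = 0 → wedge c b = 0 → False := by
    intro c hc h1 h2
    refine hc (eq_zero_of_wedge hab ?_ ?_) <;> rw [wedge_swap, neg_eq_zero] <;> assumption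
  have ha'0 := left_ne_zero_of_wedge hab'
  have hb'0 := right_ne_zero_of_wedge hab'
  -- Independence of `a` and `b` puts them on different lines; if they occur in the opposite order,
  -- `n` and its conjugate are exchanged.
  rcases ha1 with ha1 | ha1 <;> rcases hb1 with hb1 | hb1
  · exact (hexcl ha'0 ha1 hb1).elim
  · obtain ⟨s', hs'⟩ := hrescale ha0 ha1 ha'
    obtain ⟨t', ht'⟩ := hrescale hb0 hb1 hb'
    exact ⟨n, s', t', hn, hs', ht'⟩
  · obtain ⟨s', hs'⟩ := hrescale ha0 ha1 hb'
    obtain ⟨t', ht'⟩ := hrescale hb0 hb1 ha'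
    exact ⟨star n, s', t', hn.star, hs', by rw [ht', star_star]⟩
  · exact (hexcl hb'0 ha1 hb1).elim

theorem isNullConormal_z2Plane :
    IsNullConormal z2Plane ![1, Complex.I, 0, 0] where
  null := by simp [pairing_apply, Fin.sum_univ_four]
  pairing_star_ne := by
    simp [pairing_apply, Fin.sum_univ_four]
  mem_iff v := by
    have e : pairing ![1, Complex.I, 0, 0] (realVec v) = (v 0 : ℂ) + v 1 * Complex.I := by
      simp [pairing_apply, Fin.sum_univ_four, realVec]
    rw [e, z2Plane, Submodule.mem_span_pair, Complex.ext_iff]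
    simp only [Complex.add_re, Complex.ofReal_re, Complex.re_ofReal_mul, Complex.I_re, mul_zero,
      add_zero, Complex.zero_re, Complex.add_im, Complex.ofReal_im, Complex.im_ofReal_mul,
      Complex.I_im, mul_one, zero_add, Complex.zero_im]
    constructor
    · rintro ⟨x, y, rfl⟩
      simp
    · rintro ⟨h0, h1⟩
      refine ⟨v 2, v 3, ?_⟩
      ext j
      fin_cases j <;> simp [h0, h1]

/-- The covector `dz₁` is dual to `2 ∂/∂z̄₁`. The minus sign in the conjugate statement comes from
`ε₂₁ = -1`. -/
theorem gam_z2Plane : Gam ![1, 0] ![2, 0] = ![1, Complex.I, 0, 0] := by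
  rw [gam_apply]
  ext j
  fin_cases j <;> simp

theorem gam_z2Plane_star : Gam ![0, 1] ![0, -2] = star ![1, Complex.I, 0, 0] := by
  rw [gam_apply]
  ext j
  fin_cases j <;> simp [neg_div]

/-! ### The map to `ℂ` with kernel `P`, and pull-back of forms along it. -/

/-- The real linear function on `ℝ⁴` with complex values given by a covector. -/
def planeMap (n : CVec) : R4 →L[ℝ] ℂ :=
  LinearMap.toContinuousLinearMap ((pairing n).restrictScalars ℝ ∘ₗ realVec)

theorem planeMap_apply (n : CVec) (v : R4) : planeMap n v = pairing n (realVec v) := rfl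

theorem planeMap_single (n : CVec) (j : Fin 4) :
    planeMap n (EuclideanSpace.single j 1) = n j := by
  rw [planeMap_apply, pairing_apply]
  rw [Finset.sum_eq_single j (fun k _ hk => by simp [realVec, hk]) (by simp)]
  simp [realVec]

theorem IsNullConormal.planeMap_surjective {P : Submodule ℝ R4} {n : CVec}
    (h : IsNullConormal P n) : Function.Surjective (planeMap n) := by
  intro z
  obtain ⟨N, hN⟩ : ∃ N : ℝ, (N : ℂ) = pairing n (Star.star n) := by
    refine ⟨∑ j, Complex.normSq (n j), ?_⟩
    rw [pairing_apply]
    push_cast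
    exact Finset.sum_congr rfl fun j _ => Complex.normSq_eq_conj_mul_self
  have hN0 := h.pairing_star_ne
  rw [← hN] at hN0
  -- Complexified, this real vector is `(z n̄ + z̄ n)/N` with `N = (n,n̄)`; pairing with the null
  -- vector `n` leaves `z`.
  refine ⟨WithLp.toLp 2 fun j => 2 * (z * Star.star (n j)).re / N, ?_⟩
  have e : realVec (WithLp.toLp 2 fun j => 2 * (z * Star.star (n j)).re / N) =
      (z / N) • Star.star n + (Star.star z / N) • n := by
    ext j
    have h2 := Complex.add_conj (z * (starRingEnd ℂ) (n j))
    rw [map_mul, Complex.conj_conj] at h2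
    change ((2 * (z * (starRingEnd ℂ) (n j)).re / N : ℝ) : ℂ) =
      z / N * (starRingEnd ℂ) (n j) + (starRingEnd ℂ) z / N * n j
    rw [Complex.ofReal_div, ← h2]
    ring
  rw [planeMap_apply, e, map_add, map_smul, map_smul, h.null, ← hN]
  simp [hN0]

section Forms

variable {P : Submodule ℝ R4} {V : Type*} [NormedAddCommGroup V] [NormedSpace ℂ V]

/-- The chain rule `∂_v(f ∘ w) = n(v) ∂f/∂z + n̄(v) ∂f/∂z̄`, rewritten in terms of `∂/∂x` and
`∂/∂y`. -/
theorem cDeriv_pullFun (n v : CVec) (hw : ∀ x ∈ P, planeMap n x = 0)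
    (f : smoothInv (⊥ : Submodule ℝ ℂ) V) :
    cDeriv P V v (pullFun P V (planeMap n) hw f) = pullFun P V (planeMap n) hw
      (((pairing n v + pairing (star n) v) / 2) • dirDeriv ⊥ V 1 f +
        (Complex.I * (pairing (star n) v - pairing n v) / 2) • dirDeriv ⊥ V Complex.I f) := by
  refine Subtype.ext (funext fun x => ?_)
  have h1 : ∀ y z, fderiv ℝ f.1 y z =
      (z.re : ℂ) • fderiv ℝ f.1 y 1 + (z.im : ℂ) • fderiv ℝ f.1 y Complex.I := by
    intro y z
    conv_lhs => rw [show z = z.re • (1 : ℂ) + z.im • Complex.I by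
      simp [Complex.re_add_im]]
    rw [map_add, map_smul, map_smul, Complex.coe_smul, Complex.coe_smul]
  have h2 : ∀ j, fderiv ℝ (fun y => f.1 (planeMap n y)) x (EuclideanSpace.single j 1) =
      fderiv ℝ f.1 (planeMap n x) (n j) := by
    intro j
    have hf : DifferentiableAt ℝ f.1 (planeMap n x) := f.2.1.differentiable (by simp) _
    have h3 := (hf.hasFDerivAt.comp x (planeMap n).hasFDerivAt).fderiv
    change fderiv ℝ (f.1 ∘ planeMap n) x _ = _
    rw [h3, ContinuousLinearMap.comp_apply, planeMap_single]
  have h4 : (cDeriv P V v (pullFun P V (planeMap n) hw f)).1 x =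
      ∑ j, v j • fderiv ℝ (fun y => f.1 (planeMap n y)) x (EuclideanSpace.single j 1) := by
    simp [cDeriv, LinearMap.sum_apply, Finset.sum_apply, dirDeriv, pullFun]
  rw [h4]
  change _ = ((pairing n v + pairing (star n) v) / 2) • fderiv ℝ f.1 (planeMap n x) 1 +
    (Complex.I * (pairing (star n) v - pairing n v) / 2) •
      fderiv ℝ f.1 (planeMap n x) Complex.I
  have hre : ∀ j, ((n j).re : ℂ) = (n j + star (n j)) / 2 := fun j => by
    rw [Complex.star_def, Complex.add_conj]; push_cast; ring
  have him : ∀ j, ((n j).im : ℂ) = Complex.I * (star (n j) - n j) / 2 := fun j => by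
    have h5 := Complex.sub_conj (n j)
    rw [Complex.star_def]
    push_cast at h5
    linear_combination (Complex.I / 2) * h5 + (n j).im * Complex.I_mul_I
  simp only [h2, h1 _ (n _), hre, him, pairing_apply, Pi.star_apply, smul_add, smul_smul,
    Finset.sum_add_distrib, ← Finset.sum_smul]
  congr 2
  · rw [← Finset.sum_add_distrib, Finset.sum_div]
    exact Finset.sum_congr rfl fun j _ => by ring
  · rw [← Finset.sum_sub_distrib, Finset.mul_sum, Finset.sum_div]
    exact Finset.sum_congr rfl fun j _ => by ring

theorem dbar_pullForms (w : R4 →L[ℝ] ℂ) (hw : ∀ x ∈ P, w x = 0) (h : (ℂ × ℂ) →ₗ[ℂ] Spinor)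
    (ε : Spinor) (D : smoothInv (⊥ : Submodule ℝ ℂ) V →ₗ[ℂ] smoothInv (⊥ : Submodule ℝ ℂ) V)
    (θ : ℂ × ℂ)
    (hD : ∀ i f, cDeriv P V (nullVec ε i) (pullFun P V w hw f) = h θ i • pullFun P V w hw (D f))
    (η : OmegaC V) :
    dbar P V ε (pullForms P V w hw h η) = pullForms P V w hw h (wedgeOp D θ η) := by
  suffices H : dbar P V ε ∘ₗ pullForms P V w hw h = pullForms P V w hw h ∘ₗ wedgeOp D θ from
    LinearMap.congr_fun H η
  refine TensorProduct.ext' fun f l => ?_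
  have hθ : ExteriorAlgebra.ι ℂ (h θ) =
      ∑ i, h θ i • ExteriorAlgebra.ι ℂ (Pi.single i (1 : ℂ) : Spinor) := by
    rw [← Finset.sum_congr rfl fun i _ => map_smul _ _ _, ← map_sum]
    congr 1
    ext j
    simp [Finset.sum_apply, Pi.single_apply]
  simp only [LinearMap.comp_apply, pullForms_eq, TensorProduct.map_tmul, dbar_tmul, hD, wedgeOp,
    LinearMap.mulLeft_apply, AlgHom.toLinearMap_apply, map_mul, ExteriorAlgebra.map_apply_ι, hθ,
    Finset.sum_mul, TensorProduct.tmul_sum]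
  refine Finset.sum_congr rfl fun i _ => ?_
  rw [smul_mul_assoc, TensorProduct.smul_tmul]

/-- Linearity in the supercharge is what lets one isomorphism serve the whole family `xa + yb`. -/
theorem dbar_add_smul (x y : ℂ) (a b : Spinor) :
    dbar P V (x • a + y • b) = x • dbar P V a + y • dbar P V b := by
  refine TensorProduct.ext' fun f l => ?_
  have e : ∀ i, cDeriv P V (nullVec (x • a + y • b) i) f =
      x • cDeriv P V (nullVec a i) f + y • cDeriv P V (nullVec b i) f := by
    intro i
    rw [nullVec_add_smul]
    simp only [cDeriv, Pi.add_apply, Pi.smul_apply, smul_eq_mul, add_smul, mul_smul,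
      Finset.sum_add_distrib, LinearMap.add_apply, ← Finset.smul_sum, LinearMap.smul_apply]
  simp only [LinearMap.add_apply, LinearMap.smul_apply, dbar_tmul, e, TensorProduct.add_tmul,
    Finset.sum_add_distrib, TensorProduct.smul_tmul', Finset.smul_sum]

/-- The odd substitution attached to a null conormal `n` and the spinors `a`, `b`. -/
def oddMap (n : CVec) (a b : Spinor) : (ℂ × ℂ) →ₗ[ℂ] Spinor where
  toFun z i := z.1 * pairing n (nullVec b i) + z.2 * pairing (star n) (nullVec a i)
  map_add' z z' := by ext i; simp; ring
  map_smul' c z := by ext i; simp; ring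

theorem oddMap_dz (n : CVec) (a b : Spinor) (i : Fin 2) :
    oddMap n a b dz i = pairing n (nullVec b i) := by
  simp [oddMap, dz]

theorem oddMap_dzbar (n : CVec) (a b : Spinor) (i : Fin 2) :
    oddMap n a b dzbar i = pairing (star n) (nullVec a i) := by
  simp [oddMap, dzbar]

theorem wedge_self (a : Spinor) : wedge a a = 0 := by
  simp only [wedge]; ring

variable {n : CVec} {a b s t : Spinor}

/-- Because `a∧a = 0`. This removes `∂/∂z` from `∂̄_a` and, applied to `n̄` and `b`, removes `∂/∂z̄`
from `∂̄_b`. -/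
theorem pairing_nullVec_left (ha : Gam a s = n) (i : Fin 2) : pairing n (nullVec a i) = 0 := by
  rw [← ha, ← gam_single, pairing_gam, wedge_self, zero_mul, mul_zero]

/-- Up to a common factor `a∧b` and signs, `dz` and `dz̄` go to the linear forms `s∧·` and `t∧·`,
which are independent since `s∧t ≠ 0`. -/
theorem oddMap_injective (h : IsNullConormal P n) (ha : Gam a s = n)
    (hb : Gam b t = Star.star n) : Function.Injective (oddMap n a b) := by
  obtain ⟨hab, hst⟩ := h.wedge_ne_zero ha hb
  have hba : wedge b a = -wedge a b := wedge_swap b a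
  rw [← LinearMap.ker_eq_bot, LinearMap.ker_eq_bot']
  rintro ⟨x, y⟩ hxy
  have e : ∀ i, x * wedge s (Pi.single i 1) = y * wedge t (Pi.single i 1) := by
    intro i
    have h1 : x * pairing n (nullVec b i) + y * pairing (Star.star n) (nullVec a i) = 0 :=
      congrFun hxy i
    rw [← gam_single, ← gam_single, ← hb, ← ha, pairing_gam, pairing_gam, hba] at h1
    refine mul_left_cancel₀ hab ?_
    linear_combination -2 * h1
  have e0 := e 0
  have e1 := e 1
  simp [wedge] at e0 e1
  refine Prod.ext ?_ ?_
  · refine (mul_eq_zero.1 ?_).resolve_right hst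
    change x * wedge s t = 0
    simp only [wedge]
    linear_combination t 1 * e1 - t 0 * e0
  · refine (mul_eq_zero.1 ?_).resolve_right hst
    change y * wedge s t = 0
    simp only [wedge]
    linear_combination s 1 * e1 - s 0 * e0

/-- The odd substitution as an isomorphism. -/
def oddEquiv (h : IsNullConormal P n) (ha : Gam a s = n) (hb : Gam b t = Star.star n) :
    (ℂ × ℂ) ≃ₗ[ℂ] Spinor :=
  LinearMap.linearEquivOfInjective (oddMap n a b) (oddMap_injective h ha hb) (by simp)

theorem oddEquiv_toLinearMap (h : IsNullConormal P n) (ha : Gam a s = n)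
    (hb : Gam b t = Star.star n) : (oddEquiv h ha hb).toLinearMap = oddMap n a b :=
  LinearMap.ext fun _ => rfl

theorem dbar_pullForms_delbar (hw : ∀ x ∈ P, planeMap n x = 0) (ha : Gam a s = n)
    (η : OmegaC V) :
    dbar P V a (pullForms P V (planeMap n) hw (oddMap n a b) η) =
      pullForms P V (planeMap n) hw (oddMap n a b) (delbar V η) := by
  refine dbar_pullForms _ hw _ a _ dzbar (fun i f => ?_) η
  rw [cDeriv_pullFun, oddMap_dzbar, pairing_nullVec_left ha]
  simp only [LinearMap.add_apply, LinearMap.smul_apply, map_add, map_smul]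
  module

theorem dbar_pullForms_del (hw : ∀ x ∈ P, planeMap n x = 0) (hb : Gam b t = star n)
    (η : OmegaC V) :
    dbar P V b (pullForms P V (planeMap n) hw (oddMap n a b) η) =
      pullForms P V (planeMap n) hw (oddMap n a b) (del V η) := by
  refine dbar_pullForms _ hw _ b _ dz (fun i f => ?_) η
  rw [cDeriv_pullFun, oddMap_dz, pairing_nullVec_left hb]
  simp only [LinearMap.add_apply, LinearMap.smul_apply, map_add, map_smul]
  module

theorem bgDiff_bgPull (hw : ∀ x ∈ P, planeMap n x = 0) (ha : Gam a s = n)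
    (hb : Gam b t = star n) (x y : ℂ) (η) :
    bgDiff P V (x • a + y • b) (bgPull P V (planeMap n) hw (oddMap n a b) η) =
      bgPull P V (planeMap n) hw (oddMap n a b) (bgHodgeDiff V x y η) := by
  refine Prod.ext ?_ ?_ <;>
  · simp only [bgDiff, bgPull, bgHodgeDiff, LinearMap.prodMap_apply, dbar_add_smul,
      LinearMap.add_apply, LinearMap.smul_apply, dbar_pullForms_delbar hw ha,
      dbar_pullForms_del hw hb, map_add, map_smul]

theorem bgPull_bijective (h : IsNullConormal P n) (ha : Gam a s = n)
    (hb : Gam b t = Star.star n) (hw : ∀ x ∈ P, planeMap n x = 0) :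
    Function.Bijective (bgPull P V (planeMap n) hw (oddMap n a b)) := by
  rw [← oddEquiv_toLinearMap h ha hb]
  have h1 := pullForms_bijective P V (planeMap n) h.mem_iff h.planeMap_surjective
    (oddEquiv h ha hb)
  have h2 := pullForms_bijective P (V →L[ℂ] ℂ) (planeMap n) h.mem_iff h.planeMap_surjective
    (oddEquiv h ha hb)
  exact ⟨h1.1.prodMap h2.1, h1.2.prodMap h2.2⟩

theorem IsNullConormal.mem_dualAnnihilator_iff (h : IsNullConormal P n)
    (ξ : Module.Dual ℂ CVec) : ξ ∈ (complexify P).dualAnnihilator ↔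
      ∃ x y : ℂ, ξ = x • pairing n + y • pairing (Star.star n) := by
  rw [h.complexify_eq, ← LinearMap.range_dualMap_eq_dualAnnihilator_ker]
  constructor
  · rintro ⟨η, rfl⟩
    refine ⟨η (1, 0), η (0, 1), LinearMap.ext fun v => ?_⟩
    have e : ((pairing n).prod (pairing (Star.star n))) v =
        pairing n v • ((1 : ℂ), (0 : ℂ)) + pairing (Star.star n) v • ((0 : ℂ), (1 : ℂ)) := by
      ext <;> simp
    rw [LinearMap.dualMap_apply, e, map_add, map_smul, map_smul]
    simp [mul_comm]
  · rintro ⟨x, y, rfl⟩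
    exact ⟨x • LinearMap.fst ℂ ℂ ℂ + y • LinearMap.snd ℂ ℂ ℂ, LinearMap.ext fun v => by simp⟩

theorem mem_symbolSpace_iff (h : IsNullConormal P n) (ε θ : Spinor) :
    θ ∈ symbolSpace P ε ↔ ∃ x y : ℂ, θ = fun i =>
      x * pairing n (nullVec ε i) + y * pairing (Star.star n) (nullVec ε i) := by
  constructor
  · rintro ⟨ξ, hξ, rfl⟩
    obtain ⟨x, y, rfl⟩ := (h.mem_dualAnnihilator_iff ξ).1 hξ
    exact ⟨x, y, rfl⟩
  · rintro ⟨x, y, rfl⟩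
    exact ⟨x • pairing n + y • pairing (Star.star n), (h.mem_dualAnnihilator_iff _).2 ⟨x, y, rfl⟩,
      rfl⟩

/-- The covectors vanishing on `P` are spanned by `n` and `n̄`. Since `n̄` kills `Γ(b,S₋)`, only the
image of `dz` survives. -/
theorem map_oddMap_span_dz (h : IsNullConormal P n) (hb : Gam b t = Star.star n) :
    (Submodule.span ℂ {dz}).map (oddMap n a b) = symbolSpace P b := by
  ext θ
  rw [Submodule.map_span, Set.image_singleton, Submodule.mem_span_singleton,
    mem_symbolSpace_iff h]
  simp only [pairing_nullVec_left hb, mul_zero, add_zero, exists_const]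
  refine exists_congr fun x => eq_comm.trans (Eq.congr_right ?_)
  ext i
  rw [Pi.smul_apply, oddMap_dz, smul_eq_mul]

theorem map_oddMap_span_dzbar (h : IsNullConormal P n) (ha : Gam a s = n) :
    (Submodule.span ℂ {dzbar}).map (oddMap n a b) = symbolSpace P a := by
  ext θ
  rw [Submodule.map_span, Set.image_singleton, Submodule.mem_span_singleton,
    mem_symbolSpace_iff h]
  simp only [pairing_nullVec_left ha, mul_zero, zero_add, exists_const]
  refine exists_congr fun x => eq_comm.trans (Eq.congr_right ?_)
  ext i
  rw [Pi.smul_apply, oddMap_dzbar, smul_eq_mul]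

theorem pullForms_mem_bidegree_iff (h : IsNullConormal P n) (ha : Gam a s = n)
    (hb : Gam b t = Star.star n) (hw : ∀ x ∈ P, planeMap n x = 0) (p q : ℤ) (η : OmegaC V) :
    pullForms P V (planeMap n) hw (oddMap n a b) η ∈
        bidegree P V (symbolSpace P b) (symbolSpace P a) p q ↔
      η ∈ bidegree ⊥ V (Submodule.span ℂ {dz}) (Submodule.span ℂ {dzbar}) p q := by
  have hinj : Function.Injective (pullForms P V (planeMap n) hw (oddMap n a b)) := by
    rw [← oddEquiv_toLinearMap h ha hb]
    exact (pullForms_bijective P V (planeMap n) h.mem_iff h.planeMap_surjective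
      (oddEquiv h ha hb)).1
  rw [← map_oddMap_span_dz (a := a) h hb, ← map_oddMap_span_dzbar (b := b) h ha,
    ← map_bidegree P V (pullFun P V (planeMap n) hw)
      (pullFun_bijective P V (planeMap n) h.mem_iff h.planeMap_surjective).2, ← pullForms_eq]
  exact hinj.mem_set_image

end Forms

/-! ### The reduced `βγ` system as a double complex isomorphic to the Hodge one. -/

section Reduction

variable {P : Submodule ℝ R4} (V : Type*) [NormedAddCommGroup V] [NormedSpace ℂ V]
variable {n : CVec} {a b s t : Spinor}

theorem IsNullConormal.planeMap_eq_zero (h : IsNullConormal P n) : ∀ x ∈ P, planeMap n x = 0 :=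
  fun x hx => (h.mem_iff x).1 hx

/-- The isomorphism of the forms on `ℂ` with the reduced fields. -/
def bgEquiv (h : IsNullConormal P n) (ha : Gam a s = n) (hb : Gam b t = Star.star n) :
    (OmegaC V × OmegaC (V →L[ℂ] ℂ)) ≃ₗ[ℂ] (Fields P V × Fields P (V →L[ℂ] ℂ)) :=
  LinearEquiv.ofBijective (bgPull P V (planeMap n) h.planeMap_eq_zero (oddMap n a b))
    (bgPull_bijective h ha hb h.planeMap_eq_zero)

theorem mem_bgHodge_K_iff (h : IsNullConormal P n) (ha : Gam a s = n)
    (hb : Gam b t = Star.star n) (p q : ℤ) (η : (bgHodge V).M) :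
    η ∈ (bgHodge V).K p q ↔ bgEquiv V h ha hb η ∈ (bgReduction P V a b).K p q :=
  (and_congr (pullForms_mem_bidegree_iff h ha hb h.planeMap_eq_zero p q η.1)
    (pullForms_mem_bidegree_iff h ha hb h.planeMap_eq_zero p (q + 1) η.2)).symm

theorem bgReduction_d (a b : Spinor) (η : (bgReduction P V a b).M) :
    (bgReduction P V a b).d η = bgDiff P V (a + b) η := by
  have e : ∀ (W : Type _) [NormedAddCommGroup W] [NormedSpace ℂ W],
      dbar P W (a + b) = dbar P W b + dbar P W a := by
    intro W _ _
    have := dbar_add_smul (P := P) (V := W) 1 1 a b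
    rw [one_smul, one_smul, one_smul, one_smul] at this
    rw [this, add_comm]
  rw [bgDiff, e, e]
  rfl

theorem bgReduction_d_bgEquiv (h : IsNullConormal P n) (ha : Gam a s = n)
    (hb : Gam b t = Star.star n) (η : (bgHodge V).M) :
    (bgReduction P V a b).d (bgEquiv V h ha hb η) = bgEquiv V h ha hb ((bgHodge V).d η) := by
  refine (bgReduction_d V a b _).trans ?_
  have h1 := bgDiff_bgPull (V := V) h.planeMap_eq_zero ha hb 1 1 η
  have h2 : bgHodgeDiff V 1 1 = (bgHodge V).d := by
    rw [bgHodgeDiff]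
    simp only [one_smul]
    rw [add_comm (delbar V), add_comm (delbar (V →L[ℂ] ℂ))]
    rfl
  rw [one_smul, one_smul, h2] at h1
  exact h1

theorem isInternal_bgReduction (h : IsNullConormal P n) (ha : Gam a s = n)
    (hb : Gam b t = Star.star n) :
    DirectSum.IsInternal fun pq : ℤ × ℤ => (bgReduction P V a b).K pq.1 pq.2 :=
  DoubleComplex.isInternal_of_equiv (C := bgHodge V) (D := bgReduction P V a b)
    (bgEquiv V h ha hb) (mem_bgHodge_K_iff V h ha hb) (isInternal_bgHodge V)

theorem bgReduction_F_zero (h : IsNullConormal P n) (ha : Gam a s = n)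
    (hb : Gam b t = Star.star n) : (bgReduction P V a b).F 0 = ⊤ := by
  rw [← DoubleComplex.map_F (C := bgHodge V) (D := bgReduction P V a b) (bgEquiv V h ha hb)
    (mem_bgHodge_K_iff V h ha hb), bgHodge_F_zero, Submodule.map_top]
  exact LinearEquiv.range _

theorem bgReduction_F_two (h : IsNullConormal P n) (ha : Gam a s = n)
    (hb : Gam b t = Star.star n) : (bgReduction P V a b).F 2 = ⊥ := by
  rw [← DoubleComplex.map_F (C := bgHodge V) (D := bgReduction P V a b) (bgEquiv V h ha hb)
    (mem_bgHodge_K_iff V h ha hb), bgHodge_F_two, Submodule.map_bot]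

end Reduction

/-! ### The basis of holomorphic points, and the `z₂`-plane in coordinates. -/

theorem exists_twist_basis {P : Submodule ℝ R4} (hP : Module.finrank ℝ P = 2) :
    ∃ a b : Spinor, LinearIndependent ℂ ![a, b] ∧ ∀ ε : Spinor, ε ≠ 0 →
      (IsHolomorphicTwist P ε ↔ ε ∈ Submodule.span ℂ {a} ∨ ε ∈ Submodule.span ℂ {b}) ∧
      (IsBTwist P ε ↔ ¬ IsHolomorphicTwist P ε) := by
  obtain ⟨n, hn⟩ := exists_isNullConormal hP
  obtain ⟨a, s, ha⟩ := exists_gam_eq hn.null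
  obtain ⟨b, t, hb⟩ := exists_gam_eq hn.star.null
  obtain ⟨hab, -⟩ := hn.wedge_ne_zero ha hb
  refine ⟨a, b, linearIndependent_iff_wedge.2 hab, fun ε hε => ⟨?_, hn.isBTwist_iff ha hb hε⟩⟩
  rw [hn.isHolomorphicTwist_iff ha hb, mem_span_singleton_iff_wedge (left_ne_zero_of_wedge hab),
    mem_span_singleton_iff_wedge (right_ne_zero_of_wedge hab), and_iff_right hε]

theorem isHolomorphicTwist_z2Plane_iff (ε : Spinor) :
    IsHolomorphicTwist z2Plane ε ↔ ε ≠ 0 ∧ ε 0 * ε 1 = 0 := by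
  rw [isNullConormal_z2Plane.isHolomorphicTwist_iff gam_z2Plane gam_z2Plane_star]
  simp [wedge, or_comm]

theorem oddMap_z2Plane_dz : oddMap ![1, Complex.I, 0, 0] ![1, 0] ![0, 1] dz = -Pi.single 1 1 := by
  ext i
  rw [oddMap_dz, ← gam_single, gam_apply, pairing_apply, Fin.sum_univ_four]
  fin_cases i
  · simp
  · simp
    linear_combination (1 / 2) * Complex.I_mul_I

theorem oddMap_z2Plane_dzbar :
    oddMap ![1, Complex.I, 0, 0] ![1, 0] ![0, 1] dzbar = Pi.single 0 1 := by
  ext i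
  rw [oddMap_dzbar, ← gam_single, gam_apply, pairing_apply, Fin.sum_univ_four]
  fin_cases i
  · simp
    linear_combination -(1 / 2) * Complex.I_mul_I
  · simp

end BetaGamma

end

open BetaGamma in
theorem mainTheorem9 {V : Type*} [NormedAddCommGroup V] [NormedSpace ℂ V]
    [FiniteDimensional ℂ V] :
    -- The nilpotence variety is `S₊ ∪ S₋`, and `S₊ \ 0` is a component of it away from the origin.
    (nilpotenceVariety = {Q | Q.2 = 0} ∪ {Q | Q.1 = 0} ∧
      ∀ Q : Spinor × Spinor, Q ≠ 0 → Q.2 = 0 →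
        connectedComponentIn (nilpotenceVariety \ {0}) Q = {Q' | Q' ≠ 0 ∧ Q'.2 = 0}) ∧
    -- The projectivization of `S₊` is the space of complex structures on `ℝ⁴`, and the `βγ` system
    -- at `ε` is built from the Dolbeault complex of the corresponding complex structure.
    (∃ J : {ε : Spinor // ε ≠ 0} → ComplexStructures,
      (∀ ε, T01 (J ε).1 = nullTranslations ε.1) ∧
      Topology.IsQuotientMap J ∧
      (∀ ε ε', J ε = J ε' ↔ ∃ c : ℂ, ε'.1 = c • ε.1) ∧
      ∀ ε, ∃ h : Spinor ≃ₗ[ℂ] Module.Dual ℂ (T01 (J ε).1),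
        (∀ η : Fields ⊥ V, mapOdd ⊥ V h.toLinearMap (dbar ⊥ V ε.1 η) =
          dolbeault V (J ε).1 (mapOdd ⊥ V h.toLinearMap η)) ∧
        (∀ η : Fields ⊥ (V →L[ℂ] ℂ),
          mapOdd ⊥ (V →L[ℂ] ℂ) h.toLinearMap (dbar ⊥ (V →L[ℂ] ℂ) ε.1 η) =
          dolbeault (V →L[ℂ] ℂ) (J ε).1 (mapOdd ⊥ (V →L[ℂ] ℂ) h.toLinearMap η))) ∧
    -- The reduction along the `z₂`-plane, in the coordinates `(ε₊, ε₋)`.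
    ((∀ ε : Spinor, IsHolomorphicTwist z2Plane ε ↔ ε ≠ 0 ∧ ε 0 * ε 1 = 0) ∧
      ∃ (w : R4 →L[ℝ] ℂ) (hw : ∀ v ∈ z2Plane, w v = 0) (h : (ℂ × ℂ) ≃ₗ[ℂ] Spinor),
        (∀ v : R4, w v = v 0 + v 1 * Complex.I) ∧
        h dz = -Pi.single 1 1 ∧ h dzbar = Pi.single 0 1 ∧
        Function.Bijective (bgPull z2Plane V w hw h.toLinearMap) ∧
        ∀ (ε : Spinor) η, bgDiff z2Plane V ε (bgPull z2Plane V w hw h.toLinearMap η) =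
          bgPull z2Plane V w hw h.toLinearMap (bgHodgeDiff V (ε 0) (ε 1) η)) ∧
    -- The reduction along an arbitrary plane.
    (∀ P : Submodule ℝ R4, Module.finrank ℝ P = 2 →
      (∃ a b : Spinor, LinearIndependent ℂ ![a, b] ∧
        ∀ ε : Spinor, ε ≠ 0 →
          (IsHolomorphicTwist P ε ↔ ε ∈ Submodule.span ℂ {a} ∨ ε ∈ Submodule.span ℂ {b}) ∧
          (IsBTwist P ε ↔ ¬ IsHolomorphicTwist P ε)) ∧
      ∀ a b : Spinor, LinearIndependent ℂ ![a, b] →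
        IsHolomorphicTwist P a → IsHolomorphicTwist P b →
        -- The fields are `[Ω^{*,*}(ℂ), ε₊ ∂̄ + ε₋ ∂]`, for the coordinates of the basis `a, b`, and
        -- the spectral sequences agree.
        (∃ (w : R4 →L[ℝ] ℂ) (hw : ∀ v, v ∈ P ↔ w v = 0) (h : (ℂ × ℂ) ≃ₗ[ℂ] Spinor)
          (Φ : (OmegaC V × OmegaC (V →L[ℂ] ℂ)) ≃ₗ[ℂ] (Fields P V × Fields P (V →L[ℂ] ℂ))),
          (∀ η, Φ η = bgPull P V w (fun v hv => (hw v).1 hv) h.toLinearMap η) ∧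
          (∀ (x y : ℂ) η, bgDiff P V (x • a + y • b) (Φ η) = Φ (bgHodgeDiff V x y η)) ∧
          (∀ (p q : ℤ) η, η ∈ (bgHodge V).K p q ↔ Φ η ∈ (bgReduction P V a b).K p q) ∧
          ∃ φ : ∀ (r : ℕ) (p q : ℤ),
              (bgHodge V).Page r p q ≃ₗ[ℂ] (bgReduction P V a b).Page r p q,
            (∀ (r : ℕ) (p q : ℤ) (z : (bgHodge V).Z r p q) (z' : (bgReduction P V a b).Z r p q),
              z'.1 = Φ z.1 → φ r p q ((bgHodge V).cls r p q z) =
                (bgReduction P V a b).cls r p q z') ∧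
            ∀ (r : ℕ) (p q : ℤ) e, φ r (p + r) (q - r + 1) ((bgHodge V).dr r p q e) =
              (bgReduction P V a b).dr r p q (φ r p q e)) ∧
        -- The spectral sequence starts from the holomorphic twist at `a` ...
        DirectSum.IsInternal (fun pq : ℤ × ℤ => (bgReduction P V a b).K pq.1 pq.2) ∧
        (∀ η, (bgReduction P V a b).d₂ η = bgDiff P V a η) ∧
        (∀ p q : ℤ, ∃ ψ : (bgReduction P V a b).H₂ p q ≃ₗ[ℂ] (bgReduction P V a b).Page 1 p q,
          ∀ x (z : (bgReduction P V a b).Z 1 p q), z.1 = x.1 →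
            ψ (Submodule.Quotient.mk x) = (bgReduction P V a b).cls 1 p q z) ∧
        -- ... and converges to the cohomology of the B-model at `a + b`.
        IsBTwist P (a + b) ∧
        (∀ η, (bgReduction P V a b).d η = bgDiff P V (a + b) η) ∧
        ∀ r : ℕ, 2 ≤ r → ∀ p q : ℤ,
          ∃ ψ : (bgReduction P V a b).GrH p q ≃ₗ[ℂ] (bgReduction P V a b).Page r p q,
            ∀ x (z : (bgReduction P V a b).Z r p q), z.1 = x.1 →
              ψ (Submodule.Quotient.mk x) = (bgReduction P V a b).cls r p q z) := by
  refine ⟨⟨nilpotenceVariety_eq, connectedComponentIn_nilpotenceVariety⟩,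
    ⟨spinorStructure, fun ε => T01_spinorMatrix ε.2, isQuotientMap_spinorStructure,
      spinorStructure_eq_iff, fun ε => ?_⟩,
    ⟨isHolomorphicTwist_z2Plane_iff, ?_⟩, fun P hP => ⟨exists_twist_basis hP, ?_⟩⟩
  · obtain ⟨h, hh⟩ := exists_odd_substitution ε.2 (T01_spinorMatrix ε.2)
    exact ⟨h, mapOdd_dbar _ _ _ hh, mapOdd_dbar _ _ _ hh⟩
  · have hn := isNullConormal_z2Plane
    have ha := gam_z2Plane
    have hb := gam_z2Plane_star
    refine ⟨planeMap ![1, Complex.I, 0, 0], hn.planeMap_eq_zero, oddEquiv hn ha hb, fun v => ?_,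
      oddMap_z2Plane_dz, oddMap_z2Plane_dzbar, bgPull_bijective hn ha hb hn.planeMap_eq_zero,
      fun ε η => ?_⟩
    · rw [planeMap_apply, pairing_apply, Fin.sum_univ_four]
      simp [realVec]
    · have e : ε = ε 0 • ![1, 0] + ε 1 • ![0, 1] := by
        ext i
        fin_cases i <;> simp
      have h1 := bgDiff_bgPull (V := V) hn.planeMap_eq_zero ha hb (ε 0) (ε 1) η
      rw [← e] at h1
      exact h1
  · intro a b hab ha hb
    have hw := linearIndependent_iff_wedge.1 hab
    obtain ⟨n, s, t, hn, hs, ht⟩ := exists_isNullConormal_of_isHolomorphicTwist hP hw ha hb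
    have hI := isInternal_bgReduction V hn hs ht
    refine ⟨⟨planeMap n, hn.mem_iff, oddEquiv hn hs ht, bgEquiv V hn hs ht, fun η => rfl,
      fun x y η => bgDiff_bgPull hn.planeMap_eq_zero hs ht x y η, mem_bgHodge_K_iff V hn hs ht,
      DoubleComplex.exists_pageEquiv (C := bgHodge V) (D := bgReduction P V a b)
        (bgEquiv V hn hs ht) (mem_bgHodge_K_iff V hn hs ht) (bgReduction_d_bgEquiv V hn hs ht)⟩,
      hI, fun η => rfl, DoubleComplex.exists_H₂_equiv_page_one _ hI, ?_, bgReduction_d V a b,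
      DoubleComplex.exists_grH_equiv_page _ (bgReduction_F_zero V hn hs ht)
        (bgReduction_F_two V hn hs ht)⟩
    -- The sum `a + b` is proportional to neither `a` nor `b`.
    refine isBTwist_of_wedge_ne_zero hn hs ht ?_ ?_
    · have e : wedge a (a + b) = wedge a b := by simp only [wedge, Pi.add_apply]; ring
      rwa [e]
    · have e : wedge b (a + b) = -wedge a b := by simp only [wedge, Pi.add_apply]; ring
      rw [e]
      exact neg_ne_zero.2 hw
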